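/- Let $k$ be a field of characteristic $0$ and $L$ an algebraic closure of $k$; let $U=(u_1,\dots,u_m)$ be parameters and $X=(x_1,\dots,x_n)$ variables, and fix a monomial order on the monomials in $X$. For $E\subset k[U]$ let $\mathbb V(E)\subset L^m$ be the set of common zeros of $E$. Let $I=\langle f_1,\dots,f_l\rangle\subset k[U,X]$, let $E,N\subset k[U]$, let $G\subset k[U,X]$ be finite, and let $t\in k[X]$. For $\bar u\in L^m$ put $I(\bar u)=\langle f_1(\bar u,X),\dots,f_l(\bar u,X)\rangle\subset L[X]$ and $G(\bar u)=\{g(\bar u,X): g\in G\}$. Suppose that for all $\bar u\in\mathbb V(E)\setminus\mathbb V(N)$: 1. $I(\bar u)$ is zero-dimensional (i.e. $\dim_L L[X]/I(\bar u)<\infty$) and $G(\bar u)$ is a Gröbner basis of $I(\bar u)$; 2. for every $g\in G$ the leading coefficient of $g$ with respect to $X$ (an element of $k[U]$) does not vanish at $\bar u$; 3. $t$ separates $\mathbb V(I(\bar u))\subset L^n$, i.e. takes distinct values at distinct points. Let $B$ be the set of monomials in $X$ that are divisible by no leading monomial with respect to $X$ of an element of $G$. For $v\in k[X]$ let $M_v$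 be a matrix over $k(U)$, indexed by $B\times B$, whose column with index $b\in B$ consists of the coefficients of a remainder of $v\,b$ on division by $G$ in $k(U)[X]$ (all denominators in the division being products of leading coefficients, with respect to $X$, of elements of $G$). Let $\mathcal X_t(U,T)\in k(U)[T]$ be the characteristic polynomial of $M_t$. Then the coefficients of $\mathcal X_t$ are defined at every $\bar u\in\mathbb V(E)\setminus\mathbb V(N)$, and there are finitely many finite sets $E_i,N_i\subset k[U]$ and polynomials $d_i\in k[U][T]$, $g_i,g_{i1},\dots,g_{in}\in k(U)[T]$ $(1\le i\le s)$ such that $$\mathbb V(E)\setminus\mathbb V(N)=\bigcup_{i=1}^s\mathbb V(E_i)\setminus\mathbb V(N_i)$$ and for every $i$ the following holds. (a) For every $\bar u\in\mathbb V(E_i)\setminus\mathbb V(N_i)$ the leading coefficient of $d_i$ in $T$ does not vanish at $\bar u$, and $d_i(\bar u,T)$ is a greatest common divisor of $\mathcal X_t(\bar u,T)$ and its derivative $\mathcal X_t'(\bar u,T)$. (b) Let $\tilde d_i\in k(U)[T]$ be $d_i$ divided by its leading coefficient, and let $q_i=\sum_{j=0}^{d}a_jT^{d-j}$, of degree $d$,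 be the quotient of $\mathcal X_t$ on division by $\tilde d_i$ in $k(U)[T]$. Then $$g_i=\sum_{a=0}^{d-1}\sum_{j=0}^{d-a-1}\mathrm{Tr}(M_{t^a})\,a_j\,T^{d-a-j-1},\qquad g_{ir}=\sum_{a=0}^{d-1}\sum_{j=0}^{d-a-1}\mathrm{Tr}(M_{x_rt^a})\,a_j\,T^{d-a-j-1}\quad(1\le r\le n).$$ (If the $i$-th piece is empty, (a) and (c) claim nothing, and $d_i$ is irrelevant.) (c) For every $\bar u\in\mathbb V(E_i)\setminus\mathbb V(N_i)$ all coefficients of $g_i,g_{i1},\dots,g_{in}$ are defined at $\bar u$, and $(\mathcal X_t(\bar u,T),g_i(\bar u,T),g_{i1}(\bar u,T),\dots,g_{in}(\bar u,T))$ is the rational univariate representation of $I(\bar u)$ associated to $t$; that is, $t$ separates $\mathbb V(I(\bar u))$, $\mathcal X_t(\bar u,T)$ is the characteristic polynomial of the multiplication by $t$ on $L[X]/I(\bar u)$, and $g_i(\bar u,T)=g(1,T)$, $g_{ir}(\bar u,T)=g(x_r,T)$, where $$g(v,T)=\sum_{\alpha\in\mathbb V(I(\bar u))}\mu(\alpha)\,v(\alpha)\prod_{y\ne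 t(\alpha),\ \mathcal X_t(\bar u,y)=0}(T-y)$$ with $\mu(\alpha)$ the multiplicity of $\alpha$ and the product over distinct roots $y$. Moreover $g_i(\bar u,\beta)\neq0$ for every root $\beta\in L$ of $\mathcal X_t(\bar u,T)$, and $$\mathbb V(I(\bar u))=\left\{\left(\frac{g_{i1}(\bar u,\beta)}{g_i(\bar u,\beta)},\dots,\frac{g_{in}(\bar u,\beta)}{g_i(\bar u,\beta)}\right)\ :\ \beta\in L,\ \mathcal X_t(\bar u,\beta)=0\right\}.$$ -/

import Mathlib

open scoped MonomialOrder

noncomputable section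

namespace ParametricRUR

/-- The ring `k[U]` of polynomials in the parameters `U = (u_1, …, u_m)`. -/
abbrev ParamRing (m : ℕ) (k : Type*) [Field k] := MvPolynomial (Fin m) k

/-- The field `k(U)` of rational functions in the parameters. -/
abbrev ParamField (m : ℕ) (k : Type*) [Field k] := FractionRing (ParamRing m k)

section Basic

variable {m n : ℕ} {k L : Type*} [Field k] [Field L] [Algebra k L]

/-! ### Specialization of the parameters -/

/-- `V_L(E) \ V_L(N)`: the parameter values at which all elements of `E` vanish and
some element of `N` does not. -/
def locallyClosed (L : Type*) [Field L] [Algebra k L] (E N : Set (ParamRing m k)) :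
    Set (Fin m → L) :=
  {u | ∀ p ∈ E, MvPolynomial.aeval u p = 0} \ {u | ∀ p ∈ N, MvPolynomial.aeval u p = 0}

/-- `f(u, X) ∈ L[X]` for `f ∈ k[U][X]` and `u ∈ L^m`. -/
def specialize (u : Fin m → L) (f : MvPolynomial (Fin n) (ParamRing m k)) :
    MvPolynomial (Fin n) L :=
  MvPolynomial.map (MvPolynomial.aeval u : ParamRing m k →ₐ[k] L).toRingHom f

/-- `I(u) = ⟨f_1(u, X), …, f_l(u, X)⟩ ⊆ L[X]`. -/
def specializedIdeal {l : ℕ} (f : Fin l → MvPolynomial (Fin n) (ParamRing m k))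
    (u : Fin m → L) : Ideal (MvPolynomial (Fin n) L) :=
  Ideal.span (Set.range fun i => specialize u (f i))

/-- The rational function `c ∈ k(U)`, written in lowest terms `p / q`, is defined at `u`,
that is `q(u) ≠ 0`. -/
def IsDefinedAt (u : Fin m → L) (c : ParamField m k) : Prop :=
  MvPolynomial.aeval u (IsFractionRing.den (ParamRing m k) c : ParamRing m k) ≠ 0

/-- The value `c(u) = p(u) / q(u)` of a rational function `c = p / q ∈ k(U)` in lowest terms
(meaningful where `c` is defined). -/
def evalFrac (u : Fin m → L) (c : ParamField m k) : L :=
  MvPolynomial.aeval u (IsFractionRing.num (ParamRing m k) c) /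
    MvPolynomial.aeval u (IsFractionRing.den (ParamRing m k) c : ParamRing m k)

/-- All coefficients of `p ∈ k(U)[T]` are defined at `u`. -/
def PolyDefinedAt (u : Fin m → L) (p : Polynomial (ParamField m k)) : Prop :=
  ∀ i, IsDefinedAt u (p.coeff i)

/-- `p(u, T) ∈ L[T]` for `p ∈ k(U)[T]`: every coefficient is evaluated at `u`. -/
def specializePoly (u : Fin m → L) (p : Polynomial (ParamField m k)) : Polynomial L :=
  ∑ i ∈ Finset.range (p.natDegree + 1), Polynomial.monomial i (evalFrac u (p.coeff i))

/-! ### Zero-dimensional ideals, Gröbner bases, separating elements -/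

/-- The ideal `I ⊆ L[X]` is zero-dimensional: `L[X] / I` is a finite-dimensional space. -/
def ZeroDimensional (I : Ideal (MvPolynomial (Fin n) L)) : Prop :=
  Module.Finite L (MvPolynomial (Fin n) L ⧸ I)

/-- `G` is a Gröbner basis of `I`: it is contained in `I`, and the leading monomial of every
nonzero element of `I` is divisible by that of some nonzero element of `G`. -/
def IsGroebnerBasis (ord : MonomialOrder (Fin n)) (G : Set (MvPolynomial (Fin n) L))
    (I : Ideal (MvPolynomial (Fin n) L)) : Prop :=
  (∀ g ∈ G, g ∈ I) ∧
    ∀ f ∈ I, f ≠ 0 → ∃ g ∈ G, g ≠ 0 ∧ ord.degree g ≤ ord.degree f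

/-- `t` takes distinct values at distinct points of `V_L(I)`. -/
def IsSeparating (t : MvPolynomial (Fin n) L) (I : Ideal (MvPolynomial (Fin n) L)) : Prop :=
  ∀ p₁ ∈ MvPolynomial.zeroLocus L I, ∀ p₂ ∈ MvPolynomial.zeroLocus L I, p₁ ≠ p₂ →
    MvPolynomial.eval p₁ t ≠ MvPolynomial.eval p₂ t

/-! ### Rational univariate representations -/

/-- The multiplicative set of polynomials that do not vanish at `p`. -/
def nonvanishingAt (p : Fin n → L) : Submonoid (MvPolynomial (Fin n) L) where
  carrier := {f | MvPolynomial.eval p f ≠ 0}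
  one_mem' := by simp
  mul_mem' := fun {a b} ha hb => by
    change MvPolynomial.eval p (a * b) ≠ 0
    rw [map_mul]
    exact mul_ne_zero ha hb

/-- The multiplicity `μ(p)` of `p` as a zero of `I`: the dimension of the localization of
`L[X] / I` at the point `p`. -/
def multiplicity (I : Ideal (MvPolynomial (Fin n) L)) (p : Fin n → L) : ℕ :=
  Module.finrank L (Localization ((nonvanishingAt p).map (Ideal.Quotient.mk I)))

open Classical in
/-- `g(v, T) = ∑_{α ∈ V(I)} μ(α) v(α) ∏_{y ∈ V(χ), y ≠ t(α)} (T - y)`. -/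
def rurNumerator (I : Ideal (MvPolynomial (Fin n) L)) (t : MvPolynomial (Fin n) L)
    (χ : Polynomial L) (v : MvPolynomial (Fin n) L) : Polynomial L :=
  ∑ᶠ α ∈ MvPolynomial.zeroLocus L I,
    Polynomial.C ((multiplicity I α : L) * MvPolynomial.eval α v) *
      ∏ y ∈ χ.roots.toFinset.erase (MvPolynomial.eval α t),
        (Polynomial.X - Polynomial.C y)

/-- `(χ, g, h_1, …, h_n)` is the rational univariate representation of the zero-dimensional
ideal `I ⊆ L[X]` (over an algebraically closed field `L`) associated to `t`: the polynomial `t`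
separates `V_L(I)`, `χ` is the characteristic polynomial of the multiplication by `t` on
`L[X] / I`, `g = g(1, T)`, and `h_j = g(x_j, T)`. -/
def IsRUR (I : Ideal (MvPolynomial (Fin n) L)) (t : MvPolynomial (Fin n) L)
    (χ g : Polynomial L) (h : Fin n → Polynomial L) : Prop :=
  ∃ _ : Module.Finite L (MvPolynomial (Fin n) L ⧸ I),
    IsSeparating t I ∧
    χ = (LinearMap.mulLeft L (Ideal.Quotient.mk I t)).charpoly ∧
    g = rurNumerator I t χ 1 ∧
    ∀ j, h j = rurNumerator I t χ (MvPolynomial.X j)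

/-! ### Multiplication matrices over `k(U)` -/

/-- The monomials in `X` that are not divisible by the leading monomial (with respect to `X`) of
any element of `G`. -/
def standardMonomials (ord : MonomialOrder (Fin n))
    (G : Finset (MvPolynomial (Fin n) (ParamRing m k))) : Set (Fin n →₀ ℕ) :=
  {α | ∀ g ∈ G, ¬ ord.degree g ≤ α}

/-- `c ∈ k(U)` can be written as a fraction whose denominator is a product of leading
coefficients (with respect to `X`) of elements of `G`. -/
def HasLeadingDenominator (ord : MonomialOrder (Fin n))
    (G : Finset (MvPolynomial (Fin n) (ParamRing m k))) (c : ParamField m k) : Prop :=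
  ∃ p : ParamRing m k, ∃ s ∈ Submonoid.closure (ord.leadingCoeff '' (G : Set _)),
    c * algebraMap (ParamRing m k) (ParamField m k) s =
      algebraMap (ParamRing m k) (ParamField m k) p

/-- `r` is a remainder of `f` on division by `G` in `k(U)[X]`: `f = ∑ q_g g + r`, the leading
monomials of the `q_g g` do not exceed that of `f`, no monomial of `r` is divisible by the leading
monomial of an element of `G`, and all denominators are products of leading coefficients of
elements of `G`. -/
def IsRemainder (ord : MonomialOrder (Fin n))
    (G : Finset (MvPolynomial (Fin n) (ParamRing m k)))
    (f r : MvPolynomial (Fin n) (ParamField m k)) : Prop :=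
  ∃ q : MvPolynomial (Fin n) (ParamRing m k) → MvPolynomial (Fin n) (ParamField m k),
    f = (∑ g ∈ G, q g * MvPolynomial.map (algebraMap _ (ParamField m k)) g) + r ∧
    (∀ g ∈ G, ord.degree (q g * MvPolynomial.map (algebraMap _ (ParamField m k)) g)
      ≼[ord] ord.degree f) ∧
    (∀ α ∈ r.support, α ∈ standardMonomials ord G) ∧
    (∀ g ∈ G, ∀ α, HasLeadingDenominator ord G ((q g).coeff α)) ∧
    ∀ α, HasLeadingDenominator ord G (r.coeff α)

/-- `M` is a matrix `M_v` over `k(U)` of the multiplication by `v ∈ k[X]` with respect to the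
standard monomials: the column with index `β` consists of the coefficients of a remainder of
`v X^β` on division by `G`. -/
def IsMulMatrix (ord : MonomialOrder (Fin n))
    (G : Finset (MvPolynomial (Fin n) (ParamRing m k))) (v : MvPolynomial (Fin n) k)
    (M : Matrix (standardMonomials ord G) (standardMonomials ord G) (ParamField m k)) : Prop :=
  ∀ β : standardMonomials ord G, ∃ r : MvPolynomial (Fin n) (ParamField m k),
    IsRemainder ord G
      (MvPolynomial.map (algebraMap k (ParamField m k)) v * MvPolynomial.monomial β.1 1) r ∧
    ∀ α : standardMonomials ord G, M α β = r.coeff α.1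

end Basic

theorem degree_map_of_injective {n : ℕ} {R S : Type*} [CommRing R] [CommRing S]
    (ord : MonomialOrder (Fin n)) (ψ : R →+* S) (hψ : Function.Injective ψ)
    (g : MvPolynomial (Fin n) R) : ord.degree (MvPolynomial.map ψ g) = ord.degree g := by
  simp [MonomialOrder.degree, MvPolynomial.support_map_of_injective _ hψ]

open MvPolynomial in
/-- Remainders on division by `G` exist as soon as `G` does not contain `0`. -/
theorem exists_isRemainder {m n : ℕ} {k : Type*} [Field k] (ord : MonomialOrder (Fin n))
    (G : Finset (MvPolynomial (Fin n) (ParamRing m k))) (hG : ∀ g ∈ G, g ≠ 0)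
    (p : MvPolynomial (Fin n) (ParamRing m k)) :
    ∃ r, IsRemainder ord G (MvPolynomial.map (algebraMap _ (ParamField m k)) p) r := by
  classical
  let W := Submonoid.closure (ord.leadingCoeff '' (G : Set (MvPolynomial (Fin n) (ParamRing m k))))
  have hW : W ≤ nonZeroDivisors (ParamRing m k) := by
    refine Submonoid.closure_le.2 ?_
    rintro _ ⟨g, hg, rfl⟩
    exact mem_nonZeroDivisors_of_ne_zero (ord.leadingCoeff_ne_zero_iff.2 (hG g hg))
  let A := Localization W
  have hinj : Function.Injective (algebraMap (ParamRing m k) A) := IsLocalization.injective A hW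
  let φ : A →+* ParamField m k := IsLocalization.map (S := A) (ParamField m k) (M := W) (T := nonZeroDivisors (ParamRing m k)) (RingHom.id _) hW
  have hφ : φ.comp (algebraMap (ParamRing m k) A) = algebraMap _ _ := by
    refine RingHom.ext fun x => ?_
    exact IsLocalization.map_eq (S := A) (Q := ParamField m k) (g := RingHom.id (ParamRing m k))
      (T := nonZeroDivisors (ParamRing m k)) hW x
  have hφinj : Function.Injective φ := by
    rw [injective_iff_map_eq_zero]
    intro c hc
    obtain ⟨⟨a, s⟩, hs⟩ := IsLocalization.surj W c
    have h0 := congrArg φ hs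
    rw [map_mul, hc, zero_mul, ← RingHom.comp_apply, hφ] at h0
    have ha : a = 0 := (IsFractionRing.injective (ParamRing m k) (ParamField m k)) (by
      rw [← h0, map_zero])
    rw [ha, map_zero] at hs
    exact (IsLocalization.map_units A s).mul_left_eq_zero.1 hs
  have hden : ∀ c : A, HasLeadingDenominator ord G (φ c) := by
    intro c
    obtain ⟨⟨a, s⟩, hs⟩ := IsLocalization.surj W c
    refine ⟨a, s, s.2, ?_⟩
    rw [← hφ]
    simp only [RingHom.comp_apply]
    rw [← map_mul, hs]
  let b : {g // g ∈ G} → MvPolynomial (Fin n) A := fun g => MvPolynomial.map (algebraMap _ A) g.1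
  have hb : ∀ i, IsUnit (ord.leadingCoeff (b i)) := by
    intro i
    have : ord.leadingCoeff (b i) = algebraMap _ A (ord.leadingCoeff i.1) := by
      simp only [MonomialOrder.leadingCoeff, b, degree_map_of_injective ord _ hinj, MvPolynomial.coeff_map]
    rw [this]
    exact IsLocalization.map_units A (⟨_, Submonoid.subset_closure ⟨i.1, i.2, rfl⟩⟩ : W)
  obtain ⟨q, r, h1, h2, h3⟩ := ord.div hb (MvPolynomial.map (algebraMap _ A) p)
  have hmap : ∀ g : MvPolynomial (Fin n) (ParamRing m k),
      MvPolynomial.map φ (MvPolynomial.map (algebraMap _ A) g) = MvPolynomial.map (algebraMap _ (ParamField m k)) g := by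
    intro g; rw [MvPolynomial.map_map, hφ]
  refine ⟨MvPolynomial.map φ r, fun g => if hg : g ∈ G then MvPolynomial.map φ (q ⟨g, hg⟩) else 0,
    ?_, ?_, ?_, ?_, ?_⟩
  · have := congrArg (MvPolynomial.map φ) h1
    rw [hmap, map_add, Finsupp.linearCombination_apply, Finsupp.sum_fintype _ _ (by simp), map_sum] at this
    rw [this, ← Finset.sum_attach G]
    congr 1
    refine Finset.sum_congr (by rfl) ?_
    intro i _
    simp [b, hmap]
  · intro g hg
    have := h2 ⟨g, hg⟩
    simp only [hg, dif_pos]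
    rw [← hmap, ← hmap, degree_map_of_injective ord _ hφinj, ← map_mul, degree_map_of_injective ord _ hφinj, mul_comm]
    exact this
  · intro α hα g hg hle
    rw [MvPolynomial.support_map_of_injective _ hφinj] at hα
    refine h3 α hα ⟨g, hg⟩ ?_
    simpa [b, degree_map_of_injective ord _ hinj] using hle
  · intro g hg α
    simp only [hg, dif_pos, MvPolynomial.coeff_map]
    exact hden _
  · intro α
    simp only [MvPolynomial.coeff_map]
    exact hden _

/-- Multiplication matrices over `k(U)` exist as soon as `G` does not contain `0`. -/
theorem exists_isMulMatrix {m n : ℕ} {k : Type*} [Field k] (ord : MonomialOrder (Fin n))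
    (G : Finset (MvPolynomial (Fin n) (ParamRing m k))) (hG : ∀ g ∈ G, g ≠ 0)
    (v : MvPolynomial (Fin n) k) : ∃ M, IsMulMatrix ord G v M := by
  have h : ∀ β : standardMonomials ord G, ∃ r, IsRemainder ord G
      (MvPolynomial.map (algebraMap k (ParamField m k)) v * MvPolynomial.monomial β.1 1) r := by
    intro β
    obtain ⟨r, hr⟩ := exists_isRemainder ord G hG
      (MvPolynomial.map (algebraMap k (ParamRing m k)) v * MvPolynomial.monomial β.1 1)
    refine ⟨r, ?_⟩
    rwa [map_mul, MvPolynomial.map_map, ← IsScalarTower.algebraMap_eq, MvPolynomial.map_monomial,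
      map_one] at hr
  choose r hr using h
  exact ⟨fun α β => (r β).coeff α.1, fun β => ⟨r β, hr β, fun _ => rfl⟩⟩

open Classical in
/-- The characteristic polynomial of a square matrix with finite index set (`0` if the index set
is infinite). -/
def charPoly {ι K : Type*} [Field K] (M : Matrix ι ι K) : Polynomial K :=
  if _h : Finite ι then
    letI := Fintype.ofFinite ι
    M.charpoly
  else 0

/-- The trace of a square matrix with finite index set. -/
def trace {ι K : Type*} [Field K] (M : Matrix ι ι K) : K := ∑ᶠ i, M i i

/-! ### Greatest common divisors and trace formulas -/

/-- `d` is a greatest common divisor of `a` and `b`. -/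
def IsGCD {A : Type*} [CommRing A] (d a b : A) : Prop :=
  d ∣ a ∧ d ∣ b ∧ ∀ e, e ∣ a → e ∣ b → e ∣ d

/-- The monic multiple in `k(U)[T]` of `d ∈ k[U][T]`. -/
def monicMultiple {m : ℕ} {k : Type*} [Field k] (d : Polynomial (ParamRing m k)) :
    Polynomial (ParamField m k) :=
  Polynomial.C (algebraMap (ParamRing m k) (ParamField m k) d.leadingCoeff)⁻¹ *
    d.map (algebraMap (ParamRing m k) (ParamField m k))

/-- `∑_{i=0}^{d-1} ∑_{j=0}^{d-i-1} τ_i a_j T^{d-i-j-1}`, where `q = ∑_{j=0}^{d} a_j T^{d-j}` has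
degree `d`. -/
def traceFormula {K : Type*} [Field K] (τ : ℕ → K) (q : Polynomial K) : Polynomial K :=
  ∑ i ∈ Finset.range q.natDegree, ∑ j ∈ Finset.range (q.natDegree - i),
    Polynomial.monomial (q.natDegree - i - j - 1) (τ i * q.coeff (q.natDegree - j))

end ParametricRUR

end

open ParametricRUR

noncomputable section

namespace ParametricRUR

/-! ### Parametric greatest common divisors -/

section GCD

/-! Fix a good parameter value `u`. By the Gröbner property, and because the leading coefficients
survive at `u`, the standard monomials form a basis of L[X]/I(u). Division by `G` inverts only those
leading coefficients, so each M_v has entries defined at `u` and specializes to the matrix of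
multiplication by v (`IsMulMatrix.specialization`). Hence characteristic polynomials and traces
specialize too.

Over L the Artinian algebra L[X]/I(u) is the product of its localizations at the zeros α of I(u),
which gives Tr(v) = ∑ μ(α) v(α) (`trace_mk_eq_sum`); the roots of the characteristic polynomial χ of
t are the values t(α). In characteristic 0, q = χ / gcd(χ, χ') is the product of T - y over the
distinct roots y. Horner's rule says that the double sum formed with the powers of y is q / (T - y)
(`traceFormula_pow`). By linearity, inserting Tr(v t^a) = ∑ μ(α) v(α) t(α)^a yields ∑ μ(α) v(α) q /
(T - t(α)), which is g(v, T). Evaluating at t(α) isolates one zero because t separates, so quotients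
of numerators recover the coordinates.

Only the gcd fails to be uniform in `u`. A Euclidean algorithm over k[U] that branches on the
vanishing of leading coefficients cuts the parameter set into finitely many locally closed pieces
(`hasGCDCover`). Specialization is handled through the subring `definedSubring` of k(U): it embeds
in k(U) and maps to L by evaluation, so identities are lifted to it and then evaluated. -/

theorem IsGCD.symm {A : Type*} [CommRing A] {d a b : A} (h : IsGCD d a b) : IsGCD d b a :=
  ⟨h.2.1, h.1, fun e hb ha => h.2.2 e ha hb⟩

theorem isGCD_zero_right {A : Type*} [CommRing A] (a : A) : IsGCD a a 0 :=
  ⟨dvd_rfl, dvd_zero a, fun _ h _ => h⟩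

/-- One step of pseudo-division: as `c` is a unit, replacing `a` by `c * a - e * b` does not change
the common divisors with `b`. -/
theorem IsGCD.of_reduction {A : Type*} [CommRing A] {d a b c e : A} (hc : IsUnit c)
    (h : IsGCD d (c * a - e * b) b) : IsGCD d a b := by
  refine ⟨?_, h.2.1, fun x ha hb => h.2.2 x ((ha.mul_left c).sub (hb.mul_left e)) hb⟩
  have h1 : d ∣ c * a := by
    have := h.1.add (h.2.1.mul_left e)
    rwa [sub_add_cancel] at this
  exact (hc.dvd_mul_left).1 h1

theorem IsGCD.of_unit_mul {A : Type*} [CommRing A] {d a b c : A} (hc : IsUnit c)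
    (h : IsGCD d (c * a) (c * b)) : IsGCD d a b :=
  ⟨(hc.dvd_mul_left).1 h.1, (hc.dvd_mul_left).1 h.2.1,
    fun e ha hb => h.2.2 e (ha.mul_left c) (hb.mul_left c)⟩

variable {m : ℕ} {k : Type*} (L : Type*) [Field k] [Field L] [Algebra k L]

/-- Evaluation of the parameters at `u`. -/
abbrev evalParam {L : Type*} [Field L] [Algebra k L] (u : Fin m → L) : ParamRing m k →+* L :=
  (MvPolynomial.aeval u : ParamRing m k →ₐ[k] L).toRingHom

/-- Common zeros depend only on the generated ideal. Together with Noetherianity this allows finite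
sets in place of `E` and `N`. -/
theorem locallyClosed_eq_of_span_eq {E E' N N' : Set (ParamRing m k)}
    (hE : Ideal.span E = Ideal.span E') (hN : Ideal.span N = Ideal.span N') :
    locallyClosed L E N = locallyClosed L E' N' := by
  have key : ∀ (S : Set (ParamRing m k)) (u : Fin m → L),
      (∀ p ∈ S, MvPolynomial.aeval u p = 0) ↔ Ideal.span S ≤ RingHom.ker (evalParam u) :=
    fun S u => (Ideal.span_le (I := RingHom.ker (evalParam u))).symm
  ext u
  simp only [locallyClosed, Set.mem_sdiff, Set.mem_ofPred_eq, key, hE, hN]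

theorem exists_finset_locallyClosed_eq (E N : Set (ParamRing m k)) :
    ∃ E' N' : Finset (ParamRing m k), locallyClosed L E N =
      locallyClosed L (E' : Set (ParamRing m k)) (N' : Set (ParamRing m k)) := by
  obtain ⟨E', hE⟩ := (isNoetherianRing_iff_ideal_fg (ParamRing m k)).1 inferInstance (Ideal.span E)
  obtain ⟨N', hN⟩ := (isNoetherianRing_iff_ideal_fg (ParamRing m k)).1 inferInstance (Ideal.span N)
  exact ⟨E', N', locallyClosed_eq_of_span_eq L hE.symm hN.symm⟩

open Classical in
-- The two pieces are h = 0 and h ≠ 0: some product q h with q in `N` is nonzero exactly when h and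
-- some q in `N` are.
theorem locallyClosed_split (E N : Finset (ParamRing m k)) (h : ParamRing m k) :
    locallyClosed L (E : Set (ParamRing m k)) (N : Set (ParamRing m k)) =
      locallyClosed L ((insert h E : Finset (ParamRing m k)) : Set (ParamRing m k))
        (N : Set (ParamRing m k)) ∪
        locallyClosed L (E : Set (ParamRing m k))
          ((N.image (· * h) : Finset (ParamRing m k)) : Set (ParamRing m k)) := by
  ext u
  simp only [locallyClosed, Set.mem_sdiff, Set.mem_ofPred_eq, Set.mem_union, Finset.mem_coe,
    Finset.mem_insert, Finset.mem_image, forall_eq_or_imp, forall_exists_index, and_imp,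
    forall_apply_eq_imp_iff₂, map_mul, mul_eq_zero]
  by_cases hh : MvPolynomial.aeval u h = 0 <;> simp [hh]

theorem aeval_ne_zero_of_mem_image [DecidableEq (ParamRing m k)] {E : Set (ParamRing m k)}
    {N : Finset (ParamRing m k)} {h : ParamRing m k} {u : Fin m → L}
    (hu : u ∈ locallyClosed L E
      ((N.image (· * h) : Finset (ParamRing m k)) : Set (ParamRing m k))) :
    MvPolynomial.aeval u h ≠ 0 := by
  intro hh
  refine hu.2 fun p hp => ?_
  obtain ⟨q, -, rfl⟩ := Finset.mem_image.1 (Finset.mem_coe.1 hp)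
  simp [hh]

/-- `S` is a finite union of locally closed sets on each of which a single polynomial specializes
to a greatest common divisor of the specializations of `a` and `b`. -/
def HasGCDCover (S : Set (Fin m → L)) (a b : Polynomial (ParamRing m k)) : Prop :=
  ∃ F : List (Finset (ParamRing m k) × Finset (ParamRing m k) × Polynomial (ParamRing m k)),
    (∀ u, u ∈ S ↔ ∃ x ∈ F,
      u ∈ locallyClosed L (x.1 : Set (ParamRing m k)) (x.2.1 : Set (ParamRing m k))) ∧
    ∀ x ∈ F, ∀ u ∈ locallyClosed L (x.1 : Set (ParamRing m k)) (x.2.1 : Set (ParamRing m k)),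
      MvPolynomial.aeval u x.2.2.leadingCoeff ≠ 0 ∧
      IsGCD (x.2.2.map (evalParam u)) (a.map (evalParam u)) (b.map (evalParam u))

variable {L}

theorem HasGCDCover.union {S T : Set (Fin m → L)} {a b : Polynomial (ParamRing m k)}
    (hS : HasGCDCover L S a b) (hT : HasGCDCover L T a b) : HasGCDCover L (S ∪ T) a b := by
  obtain ⟨F, hF, hF'⟩ := hS
  obtain ⟨H, hH, hH'⟩ := hT
  refine ⟨F ++ H, fun u => ?_, fun x hx => ?_⟩
  · simp only [Set.mem_union, hF, hH, List.mem_append, or_and_right, exists_or]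
  · rcases List.mem_append.1 hx with hx | hx
    exacts [hF' x hx, hH' x hx]

theorem HasGCDCover.imp {S : Set (Fin m → L)} {a b a' b' : Polynomial (ParamRing m k)}
    (hS : HasGCDCover L S a b)
    (h : ∀ u ∈ S, ∀ d, IsGCD d (a.map (evalParam u)) (b.map (evalParam u)) →
      IsGCD d (a'.map (evalParam u)) (b'.map (evalParam u))) : HasGCDCover L S a' b' := by
  obtain ⟨F, hF, hF'⟩ := hS
  exact ⟨F, hF, fun x hx u hu =>
    ⟨(hF' x hx u hu).1, h u ((hF u).2 ⟨x, hx, hu⟩) _ (hF' x hx u hu).2⟩⟩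

open Classical in
/-- `0` for the zero polynomial and one more than the degree otherwise. -/
def polySize {R : Type*} [Semiring R] (p : Polynomial R) : ℕ :=
  if p = 0 then 0 else p.natDegree + 1

theorem polySize_lt {R : Type*} [Semiring R] {p q : Polynomial R} (h : p.degree < q.degree) :
    polySize p < polySize q := by
  have hq : q ≠ 0 := by
    rintro rfl
    simp at h
  by_cases hp : p = 0
  · simp [polySize, hp, hq]
  · simp only [polySize, hp, hq, if_false]
    have := Polynomial.natDegree_lt_natDegree hp h
    omega

theorem map_eraseLead_eq {R S : Type*} [CommRing R] [CommRing S] (φ : R →+* S)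
    (p : Polynomial R) (h : φ p.leadingCoeff = 0) : p.eraseLead.map φ = p.map φ := by
  have := congrArg (Polynomial.map φ) p.eraseLead_add_monomial_natDegree_leadingCoeff
  rwa [Polynomial.map_add, Polynomial.map_monomial, h, Polynomial.monomial_zero_right,
    add_zero] at this

/-- Cross-multiplying by leading coefficients cancels the top terms without division, so the
reduction stays over k[U]. -/
theorem degree_pseudo_reduction_lt {R : Type*} [CommRing R] [IsDomain R] {a b : Polynomial R}
    (ha : a ≠ 0) (hb : b ≠ 0) (h : b.natDegree ≤ a.natDegree) :
    (Polynomial.C b.leadingCoeff * a -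
      (Polynomial.C a.leadingCoeff * Polynomial.X ^ (a.natDegree - b.natDegree)) * b).degree
        < a.degree := by
  have hla : a.leadingCoeff ≠ 0 := Polynomial.leadingCoeff_ne_zero.2 ha
  have hlb : b.leadingCoeff ≠ 0 := Polynomial.leadingCoeff_ne_zero.2 hb
  have h1 : (Polynomial.C b.leadingCoeff * a).degree = a.degree := Polynomial.degree_C_mul hlb
  rw [← h1]
  refine Polynomial.degree_sub_lt_left ?_ ?_ ?_
  · rw [h1, Polynomial.degree_mul, Polynomial.degree_C_mul_X_pow _ hla,
      Polynomial.degree_eq_natDegree ha, Polynomial.degree_eq_natDegree hb]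
    norm_cast
    omega
  · exact mul_ne_zero (Polynomial.C_ne_zero.2 hlb) ha
  · rw [Polynomial.leadingCoeff_mul, Polynomial.leadingCoeff_mul, Polynomial.leadingCoeff_C,
      Polynomial.leadingCoeff_C_mul_X_pow, mul_comm]

/-- Parametric Euclidean algorithm, by induction on the sum of the sizes. Each branch either erases
a leading term that vanishes on the piece or performs a pseudo-reduction. `hne` excludes points
where the gcd would be 0 and could have no nonvanishing leading coefficient. -/
theorem hasGCDCover (a b : Polynomial (ParamRing m k)) (E N : Finset (ParamRing m k))
    (hne : ∀ u ∈ locallyClosed L (E : Set (ParamRing m k)) (N : Set (ParamRing m k)),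
      a.map (evalParam u) ≠ 0 ∨ b.map (evalParam u) ≠ 0) :
    HasGCDCover L (locallyClosed L (E : Set (ParamRing m k)) (N : Set (ParamRing m k))) a b := by
  classical
  induction hs : polySize a + polySize b using Nat.strong_induction_on generalizing a b E N with
  | _ s ih =>
  subst hs
  wlog hab : b.degree ≤ a.degree generalizing a b
  · refine (this b a (fun u hu => (hne u hu).symm) ?_ (le_of_not_ge hab)).imp
      fun u _ d hd => hd.symm
    intro j hj a' b' E' N' h hs
    exact ih j (by omega) a' b' E' N' h hs
  by_cases ha : a = 0
  · subst ha
    have hb : b = 0 := by simpa using hab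
    subst hb
    -- Both polynomials are 0, so `hne` forces the piece to be empty.
    refine ⟨[], fun u => ⟨fun hu => ?_, by simp⟩, by simp⟩
    simpa using hne u hu
  have herase : ∀ p : Polynomial (ParamRing m k), p ≠ 0 → polySize p.eraseLead < polySize p :=
    fun p hp => polySize_lt (Polynomial.degree_eraseLead_lt hp)
  have hvan : ∀ (p : Polynomial (ParamRing m k)) (u : Fin m → L),
      u ∈ locallyClosed L ((insert p.leadingCoeff E : Finset (ParamRing m k)) : Set (ParamRing m k))
        (N : Set (ParamRing m k)) →
      p.eraseLead.map (evalParam u) = p.map (evalParam u) := fun p u hu =>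
    map_eraseLead_eq _ p (hu.1 _ (by simp))
  have hmem : ∀ (c : ParamRing m k) (u : Fin m → L),
      u ∈ locallyClosed L ((insert c E : Finset (ParamRing m k)) : Set (ParamRing m k))
        (N : Set (ParamRing m k)) →
      u ∈ locallyClosed L (E : Set (ParamRing m k)) (N : Set (ParamRing m k)) := fun c u hu => by
    rw [locallyClosed_split L E N c]; exact Or.inl hu
  by_cases hb : b = 0
  · subst hb
    rw [locallyClosed_split L E N a.leadingCoeff]
    -- Where the leading coefficient of `a` survives, `a` itself is the gcd with 0; elsewhere `a`
    -- loses its top term.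
    refine HasGCDCover.union ?_ ⟨[⟨E, N.image (· * a.leadingCoeff), a⟩], by simp, ?_⟩
    · refine (ih _ ?_ a.eraseLead 0 _ _ ?_ rfl).imp ?_
      · have := herase a ha
        omega
      · intro u hu
        rw [hvan a u hu]
        exact hne u (hmem _ u hu)
      · intro u hu d hd
        rwa [hvan a u hu] at hd
    · rintro x hx u hu
      obtain rfl := List.mem_singleton.1 hx
      refine ⟨aeval_ne_zero_of_mem_image L hu, ?_⟩
      rw [Polynomial.map_zero]
      exact isGCD_zero_right _
  · rw [locallyClosed_split L E N b.leadingCoeff]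
    refine HasGCDCover.union ?_ ?_
    · refine (ih _ ?_ a b.eraseLead _ _ ?_ rfl).imp ?_
      · have := herase b hb
        omega
      · intro u hu
        rw [hvan b u hu]
        exact hne u (hmem _ u hu)
      · intro u hu d hd
        rwa [hvan b u hu] at hd
    -- Here the leading coefficient of `b` becomes a unit at `u`, so pseudo-reduction preserves the
    -- common divisors.
    · have hdeg := degree_pseudo_reduction_lt ha hb (Polynomial.natDegree_le_natDegree hab)
      refine (ih _ ?_ (Polynomial.C b.leadingCoeff * a - (Polynomial.C a.leadingCoeff *
        Polynomial.X ^ (a.natDegree - b.natDegree)) * b) b _ _ ?_ rfl).imp ?_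
      · have := polySize_lt hdeg
        omega
      · intro u hu
        have hc := aeval_ne_zero_of_mem_image L hu
        -- The coefficient of `b` in its generic degree is nonzero at `u`, so `b` stays nonzero.
        refine Or.inr fun h0 => hc ?_
        have := congrArg (fun p : Polynomial L => p.coeff b.natDegree) h0
        simpa using this
      · intro u hu d hd
        have hc := aeval_ne_zero_of_mem_image L hu
        rw [Polynomial.map_sub, Polynomial.map_mul, Polynomial.map_mul, Polynomial.map_C] at hd
        exact hd.of_reduction (Polynomial.isUnit_C.2 (isUnit_iff_ne_zero.2 hc))

end GCD

/-! ### The ring of rational functions defined at a point -/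

section Defined

variable {m n : ℕ} {k L : Type*} [Field k] [Field L] [Algebra k L]

/-- Any fraction p / q with q(u) ≠ 0 may replace the reduced one: k[U] has unique factorization, so
the reduced denominator divides q and cannot vanish at `u`. -/
theorem isDefinedAt_and_evalFrac_mul {u : Fin m → L} {c : ParamField m k} {p q : ParamRing m k}
    (hq : MvPolynomial.aeval u q ≠ 0)
    (h : c * algebraMap (ParamRing m k) (ParamField m k) q = algebraMap _ _ p) :
    IsDefinedAt u c ∧ evalFrac u c * MvPolynomial.aeval u q = MvPolynomial.aeval u p := by
  set a := IsFractionRing.num (ParamRing m k) c with ha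
  set b := (IsFractionRing.den (ParamRing m k) c : ParamRing m k) with hb
  have hb0 : algebraMap (ParamRing m k) (ParamField m k) b ≠ 0 :=
    IsFractionRing.to_map_ne_zero_of_mem_nonZeroDivisors (IsFractionRing.den _ c).2
  have hc : c * algebraMap (ParamRing m k) (ParamField m k) b = algebraMap _ _ a :=
    IsFractionRing.num_mul_den_eq_num_iff_eq.2 rfl
  have hab : a * q = p * b := by
    apply IsFractionRing.injective (ParamRing m k) (ParamField m k)
    rw [map_mul, map_mul, ← hc, ← h]
    ring
  have hdvd : b ∣ q := by
    have hrel : IsRelPrime b a := (IsFractionRing.num_den_reduced (ParamRing m k) c).symm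
    exact hrel.dvd_of_dvd_mul_left (hab ▸ dvd_mul_left b p)
  have hbu : MvPolynomial.aeval u b ≠ 0 := by
    intro h0
    obtain ⟨e, he⟩ := hdvd
    rw [he, map_mul, h0, zero_mul] at hq
    exact hq rfl
  refine ⟨hbu, ?_⟩
  have h2 := congrArg (MvPolynomial.aeval u) hab
  rw [map_mul, map_mul] at h2
  change MvPolynomial.aeval u a / MvPolynomial.aeval u b * _ = _
  rw [div_mul_eq_mul_div, h2, mul_div_cancel_right₀ _ hbu]

theorem evalFrac_eq {u : Fin m → L} {c : ParamField m k} {p q : ParamRing m k}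
    (hq : MvPolynomial.aeval u q ≠ 0)
    (h : c * algebraMap (ParamRing m k) (ParamField m k) q = algebraMap _ _ p) :
    evalFrac u c = MvPolynomial.aeval u p / MvPolynomial.aeval u q :=
  eq_div_of_mul_eq hq (isDefinedAt_and_evalFrac_mul hq h).2

theorem IsDefinedAt.exists_fraction {u : Fin m → L} {c : ParamField m k} (h : IsDefinedAt u c) :
    ∃ p q : ParamRing m k, MvPolynomial.aeval u q ≠ 0 ∧
      c * algebraMap (ParamRing m k) (ParamField m k) q = algebraMap _ _ p :=
  ⟨_, _, h, IsFractionRing.num_mul_den_eq_num_iff_eq.2 rfl⟩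

theorem fraction_add {K : Type*} [CommRing K] {a b p q r s : K} (h : a * q = p) (h' : b * s = r) :
    (a + b) * (q * s) = p * s + r * q := by
  rw [← h, ← h']; ring

theorem fraction_mul {K : Type*} [CommRing K] {a b p q r s : K} (h : a * q = p) (h' : b * s = r) :
    (a * b) * (q * s) = p * r := by
  rw [← h, ← h']; ring

theorem isDefinedAt_algebraMap (u : Fin m → L) (p : ParamRing m k) :
    IsDefinedAt u (algebraMap (ParamRing m k) (ParamField m k) p) :=
  (isDefinedAt_and_evalFrac_mul (u := u) (p := p) (q := 1) (by simp) (by simp)).1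

theorem evalFrac_algebraMap (u : Fin m → L) (p : ParamRing m k) :
    evalFrac u (algebraMap (ParamRing m k) (ParamField m k) p) = MvPolynomial.aeval u p := by
  rw [evalFrac_eq (u := u) (p := p) (q := 1) (by simp) (by simp)]
  simp

/-- The rational functions that are defined at `u`. -/
def definedSubring (k : Type*) [Field k] [Algebra k L] (u : Fin m → L) :
    Subring (ParamField m k) where
  carrier := {c | IsDefinedAt u c}
  mul_mem' := by
    rintro a b ha hb
    obtain ⟨p, q, hq, h⟩ := IsDefinedAt.exists_fraction ha
    obtain ⟨r, s, hs, h'⟩ := IsDefinedAt.exists_fraction hb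
    refine (isDefinedAt_and_evalFrac_mul (p := p * r) (q := q * s) ?_ ?_).1
    · rw [map_mul]; exact mul_ne_zero hq hs
    · simpa only [map_mul] using fraction_mul h h'
  add_mem' := by
    rintro a b ha hb
    obtain ⟨p, q, hq, h⟩ := IsDefinedAt.exists_fraction ha
    obtain ⟨r, s, hs, h'⟩ := IsDefinedAt.exists_fraction hb
    refine (isDefinedAt_and_evalFrac_mul (p := p * s + r * q) (q := q * s) ?_ ?_).1
    · rw [map_mul]; exact mul_ne_zero hq hs
    · simpa only [map_mul, map_add] using fraction_add h h'
  one_mem' := by simpa using isDefinedAt_algebraMap u (1 : ParamRing m k)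
  zero_mem' := by simpa using isDefinedAt_algebraMap u (0 : ParamRing m k)
  neg_mem' := by
    rintro a ha
    obtain ⟨p, q, hq, h⟩ := IsDefinedAt.exists_fraction ha
    exact (isDefinedAt_and_evalFrac_mul (p := -p) (q := q) hq (by rw [neg_mul, h, map_neg])).1

/-- Evaluation at `u` of the rational functions that are defined at `u`. -/
def evalDefined (k : Type*) [Field k] [Algebra k L] (u : Fin m → L) :
    definedSubring k u →+* L where
  toFun c := evalFrac u (c : ParamField m k)
  map_one' := by simpa using evalFrac_algebraMap u (1 : ParamRing m k)
  map_zero' := by simpa using evalFrac_algebraMap u (0 : ParamRing m k)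
  map_mul' := by
    rintro ⟨a, ha⟩ ⟨b, hb⟩
    obtain ⟨p, q, hq, h⟩ := IsDefinedAt.exists_fraction ha
    obtain ⟨r, s, hs, h'⟩ := IsDefinedAt.exists_fraction hb
    have hqs : MvPolynomial.aeval u (q * s) ≠ 0 := by rw [map_mul]; exact mul_ne_zero hq hs
    have := evalFrac_eq (c := a * b) (p := p * r) hqs
      (by simpa only [map_mul] using fraction_mul h h')
    change evalFrac u (a * b) = evalFrac u a * evalFrac u b
    rw [this, evalFrac_eq hq h, evalFrac_eq hs h', map_mul, map_mul, div_mul_div_comm]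
  map_add' := by
    rintro ⟨a, ha⟩ ⟨b, hb⟩
    obtain ⟨p, q, hq, h⟩ := IsDefinedAt.exists_fraction ha
    obtain ⟨r, s, hs, h'⟩ := IsDefinedAt.exists_fraction hb
    have hqs : MvPolynomial.aeval u (q * s) ≠ 0 := by rw [map_mul]; exact mul_ne_zero hq hs
    have := evalFrac_eq (c := a + b) (p := p * s + r * q) hqs
      (by simpa only [map_mul, map_add] using fraction_add h h')
    change evalFrac u (a + b) = evalFrac u a + evalFrac u b
    rw [this, evalFrac_eq hq h, evalFrac_eq hs h', map_mul, map_add, map_mul, map_mul,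
      div_add_div _ _ hq hs]
    ring

@[simp]
theorem evalDefined_apply (u : Fin m → L) (c : definedSubring k u) :
    evalDefined k u c = evalFrac u (c : ParamField m k) := rfl

/-- A polynomial in the parameters, as a rational function defined at `u`. -/
def toDefined (k : Type*) [Field k] [Algebra k L] (u : Fin m → L) :
    ParamRing m k →+* definedSubring k u :=
  (algebraMap (ParamRing m k) (ParamField m k)).codRestrict (definedSubring k u)
    (isDefinedAt_algebraMap u)

theorem subtype_comp_toDefined (u : Fin m → L) :
    (definedSubring k u).subtype.comp (toDefined k u) = algebraMap _ _ := rfl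

theorem evalDefined_comp_toDefined (u : Fin m → L) :
    (evalDefined k u).comp (toDefined k u) = evalParam u :=
  RingHom.ext fun p => evalFrac_algebraMap u p

theorem polyDefinedAt_map {u : Fin m → L} (p : Polynomial (definedSubring k u)) :
    PolyDefinedAt u (p.map (definedSubring k u).subtype) := fun i => by
  rw [Polynomial.coeff_map]
  exact (p.coeff i).2

/-- Identifies coefficientwise evaluation with the image under a ring homomorphism, so that it
commutes with derivatives and with monic division. -/
theorem specializePoly_map {u : Fin m → L} (p : Polynomial (definedSubring k u)) :
    specializePoly u (p.map (definedSubring k u).subtype) = p.map (evalDefined k u) := by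
  ext i
  simp only [specializePoly, Polynomial.finsetSum_coeff, Polynomial.coeff_monomial,
    Finset.sum_ite_eq', Finset.mem_range, Polynomial.coeff_map, evalDefined_apply]
  split_ifs with hi
  · rfl
  · have h0 := Polynomial.coeff_eq_zero_of_natDegree_lt
      (show (p.map (definedSubring k u).subtype).natDegree < i by omega)
    rw [Polynomial.coeff_map] at h0
    rw [show ((p.coeff i : definedSubring k u) : ParamField m k) = 0 from h0]
    simpa using (evalFrac_algebraMap u (0 : ParamRing m k)).symm

theorem exists_mvPolynomial_lift {u : Fin m → L} {p : MvPolynomial (Fin n) (ParamField m k)}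
    (hp : ∀ α, IsDefinedAt u (p.coeff α)) :
    ∃ p' : MvPolynomial (Fin n) (definedSubring k u),
      MvPolynomial.map (definedSubring k u).subtype p' = p := by
  have : p ∈ Set.range (MvPolynomial.map (σ := Fin n) (definedSubring k u).subtype) := by
    refine MvPolynomial.mem_range_map_iff_coeffs_subset.2 ?_
    intro c hc
    obtain ⟨α, -, rfl⟩ := MvPolynomial.mem_coeffs_iff.1 hc
    exact ⟨⟨_, hp α⟩, rfl⟩
  exact this

theorem HasLeadingDenominator.isDefinedAt {ord : MonomialOrder (Fin n)}
    {G : Finset (MvPolynomial (Fin n) (ParamRing m k))} {u : Fin m → L}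
    (hG : ∀ g ∈ G, MvPolynomial.aeval u (ord.leadingCoeff g) ≠ 0) {c : ParamField m k}
    (hc : HasLeadingDenominator ord G c) : IsDefinedAt u c := by
  obtain ⟨p, s, hs, h⟩ := hc
  refine (isDefinedAt_and_evalFrac_mul ?_ h).1
  clear h
  induction hs using Submonoid.closure_induction with
  | mem x hx =>
    obtain ⟨g, hg, rfl⟩ := hx
    exact hG g hg
  | one => simp
  | mul x y _ _ hx hy =>
    rw [map_mul]
    exact mul_ne_zero hx hy

end Defined

/-! ### Traces on Artinian algebras -/

section Stickelberger

variable {L : Type*} [Field L]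

/-- Multiplication by an element supported on one factor passes through that factor, so cyclicity of
the trace moves the computation there. -/
theorem trace_pi_apply {ι : Type*} [Fintype ι] {B : ι → Type*} [∀ i, CommRing (B i)]
    [∀ i, Algebra L (B i)] [∀ i, Module.Finite L (B i)] (x : ∀ i, B i) :
    Algebra.trace L (∀ i, B i) x = ∑ i, Algebra.trace L (B i) (x i) := by
  classical
  have hx : x = ∑ i, Pi.single i (x i) := (Finset.univ_sum_single x).symm
  conv_lhs => rw [hx, map_sum]
  refine Finset.sum_congr rfl fun i _ => ?_
  have h1 : Algebra.lmul L (∀ i, B i) (Pi.single i (x i)) =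
      (LinearMap.single L B i) ∘ₗ ((Algebra.lmul L (B i) (x i)) ∘ₗ LinearMap.proj i) := by
    refine LinearMap.ext fun y => ?_
    ext j
    by_cases h : j = i
    · subst h; simp
    · simp [h]
  have h2 : ((Algebra.lmul L (B i) (x i)) ∘ₗ LinearMap.proj i) ∘ₗ LinearMap.single L B i =
      Algebra.lmul L (B i) (x i) := by
    refine LinearMap.ext fun y => ?_
    simp
  rw [Algebra.trace_apply, Algebra.trace_apply, h1, LinearMap.trace_comp_comm', h2]

theorem trace_eq_finrank_mul_of_isNilpotent_sub {A : Type*} [CommRing A] [Algebra L A]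
    [Module.Finite L A] {x : A} {c : L} (h : IsNilpotent (x - algebraMap L A c)) :
    Algebra.trace L A x = (Module.finrank L A : L) * c := by
  have h0 := (Algebra.isNilpotent_trace_of_isNilpotent (R := L) h).eq_zero
  rw [map_sub, sub_eq_zero, Algebra.trace_algebraMap, nsmul_eq_mul] at h0
  exact h0

variable {A : Type*} [CommRing A] [Algebra L A]

theorem finite_localization_atPrime [Module.Finite L A] (I : MaximalSpectrum A) :
    Module.Finite L (Localization.AtPrime I.1) := by
  have : IsArtinianRing A := IsArtinianRing.of_finite L A
  have hs : Function.Surjective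
      (IsScalarTower.toAlgHom L A (Localization.AtPrime I.1)).toLinearMap :=
    IsArtinianRing.localization_surjective I.1.primeCompl _
  exact Module.Finite.of_surjective _ hs

/-- An Artinian ring is the product of its localizations at maximal ideals. In each of them x minus
its residue c is nilpotent and so has trace 0, leaving c times the dimension. -/
theorem trace_eq_sum_maximalSpectrum [Module.Finite L A] [Fintype (MaximalSpectrum A)] (x : A)
    (c : MaximalSpectrum A → L) (hc : ∀ I, x - algebraMap L A (c I) ∈ I.asIdeal) :
    Algebra.trace L A x =
      ∑ I : MaximalSpectrum A, (Module.finrank L (Localization.AtPrime I.1) : L) * c I := by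
  have : IsArtinianRing A := IsArtinianRing.of_finite L A
  have := fun I : MaximalSpectrum A => finite_localization_atPrime (L := L) I
  rw [← Algebra.trace_eq_of_algEquiv
    ((MaximalSpectrum.toPiLocalizationEquiv A).restrictScalars L) x,
    trace_pi_apply]
  refine Finset.sum_congr rfl fun I _ => ?_
  refine trace_eq_finrank_mul_of_isNilpotent_sub ?_
  have : IsArtinianRing (Localization.AtPrime I.1) := IsArtinianRing.of_finite L _
  have hmem : algebraMap A (Localization.AtPrime I.1) (x - algebraMap L A (c I)) ∈
      IsLocalRing.maximalIdeal (Localization.AtPrime I.1) :=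
    (IsLocalization.AtPrime.to_map_mem_maximal_iff _ I.1 _).2 (hc I)
  rw [← IsLocalRing.jacobson_eq_maximalIdeal ⊥ bot_ne_top] at hmem
  obtain ⟨r, hr⟩ := IsArtinianRing.isNilpotent_jacobson_bot (R := Localization.AtPrime I.1)
  refine ⟨r, ?_⟩
  have := Ideal.pow_mem_pow hmem r
  rw [hr] at this
  rw [map_sub, ← IsScalarTower.algebraMap_apply] at this
  exact this

/-- Roots are eigenvalues, and multiplication by an element is invertible only if that element is a
unit: a preimage of 1 is its inverse. -/
theorem isRoot_charpoly_mulLeft_iff [Module.Finite L A] (x : A) (β : L) :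
    (LinearMap.mulLeft L x).charpoly.IsRoot β ↔ ¬ IsUnit (algebraMap L A β - x) := by
  rw [← Module.End.hasEigenvalue_iff_isRoot_charpoly, Module.End.hasEigenvalue_iff_mem_spectrum,
    spectrum.mem_iff, not_iff_not]
  have h : algebraMap L (Module.End L A) β - LinearMap.mulLeft L x =
      Algebra.lmul L A (algebraMap L A β - x) := by
    refine LinearMap.ext fun y => ?_
    simp [Algebra.smul_def]
  rw [h]
  refine ⟨fun hu => ?_, fun hu => hu.map _⟩
  obtain ⟨y, hy⟩ := ((Module.End.isUnit_iff _).1 hu).2 1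
  exact IsUnit.of_mul_eq_one y hy

end Stickelberger

/-! ### Zeros of a zero-dimensional ideal, multiplicities and Stickelberger's theorem -/

section Points

open MvPolynomial

variable {n : ℕ} {L : Type*} [Field L] {I : Ideal (MvPolynomial (Fin n) L)}

/-- Evaluation at a point of the zero locus of `I`, on the quotient by `I`. -/
def evalQuotient (p : zeroLocus L I) : (MvPolynomial (Fin n) L ⧸ I) →ₐ[L] L :=
  Ideal.Quotient.liftₐ I (aeval p.1) fun a ha => p.2 a ha

@[simp]
theorem evalQuotient_mk (p : zeroLocus L I) (v : MvPolynomial (Fin n) L) :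
    evalQuotient p (Ideal.Quotient.mk I v) = eval p.1 v := by
  simp [evalQuotient]

/-- The maximal ideal of a point of the zero locus of `I`. -/
def pointIdeal (p : zeroLocus L I) : MaximalSpectrum (MvPolynomial (Fin n) L ⧸ I) :=
  ⟨RingHom.ker (evalQuotient p), RingHom.ker_isMaximal_of_surjective _ fun c =>
    ⟨algebraMap L _ c, by simp⟩⟩

theorem mem_pointIdeal_mk {p : zeroLocus L I} {v : MvPolynomial (Fin n) L} :
    Ideal.Quotient.mk I v ∈ (pointIdeal p).asIdeal ↔ eval p.1 v = 0 := by
  rw [← evalQuotient_mk]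
  exact RingHom.mem_ker

/-- Surjectivity is the Nullstellensatz; injectivity holds because the ideal of p contains every X_i
- p_i. -/
theorem pointIdeal_bijective [IsAlgClosed L] :
    Function.Bijective (pointIdeal (L := L) (I := I)) := by
  constructor
  · intro p q h
    ext i
    have h1 : Ideal.Quotient.mk I (X i - C (p.1 i)) ∈ (pointIdeal q).asIdeal := by
      rw [← h, mem_pointIdeal_mk]
      simp
    rw [mem_pointIdeal_mk] at h1
    rw [map_sub, eval_X, eval_C, sub_eq_zero] at h1
    exact h1.symm
  · intro J
    have hJ := J.isMaximal
    have hmax : (J.asIdeal.comap (Ideal.Quotient.mk I)).IsMaximal :=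
      Ideal.comap_isMaximal_of_surjective _ Ideal.Quotient.mk_surjective
    obtain ⟨x, hx⟩ := isMaximal_iff_eq_vanishingIdeal_singleton.1 hmax
    have hmem : ∀ v, Ideal.Quotient.mk I v ∈ J.asIdeal ↔ aeval x v = 0 := fun v => by
      rw [← mem_vanishingIdeal_singleton_iff, ← hx, Ideal.mem_comap]
    refine ⟨⟨x, fun v hv => ?_⟩, ?_⟩
    · rw [← hmem, Ideal.Quotient.eq_zero_iff_mem.2 hv]
      exact J.asIdeal.zero_mem
    · ext w
      obtain ⟨v, rfl⟩ := Ideal.Quotient.mk_surjective w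
      exact mem_pointIdeal_mk.trans (hmem v).symm

theorem multiplicity_eq (p : zeroLocus L I) :
    multiplicity I p.1 = Module.finrank L (Localization.AtPrime (pointIdeal p).1) := by
  have h : (nonvanishingAt p.1).map (Ideal.Quotient.mk I) = (pointIdeal p).1.primeCompl := by
    ext w
    obtain ⟨v, rfl⟩ := Ideal.Quotient.mk_surjective w
    constructor
    · rintro ⟨v', hv', h⟩
      rw [← h]
      exact fun hm => hv' (mem_pointIdeal_mk.1 hm)
    · intro hv
      exact ⟨v, fun h0 => hv (mem_pointIdeal_mk.2 h0), rfl⟩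
  rw [multiplicity, h]

theorem multiplicity_pos [Module.Finite L (MvPolynomial (Fin n) L ⧸ I)] (p : zeroLocus L I) :
    0 < multiplicity I p.1 := by
  have := finite_localization_atPrime (L := L) (pointIdeal p)
  rw [multiplicity_eq]
  exact Module.finrank_pos (R := L) (M := Localization.AtPrime (pointIdeal p).1)

variable [IsAlgClosed L]

theorem finite_zeroLocus [Module.Finite L (MvPolynomial (Fin n) L ⧸ I)] :
    (zeroLocus L I).Finite := by
  have : IsArtinianRing (MvPolynomial (Fin n) L ⧸ I) := IsArtinianRing.of_finite L _
  exact Set.finite_coe_iff.1 (Finite.of_injective _ (pointIdeal_bijective (L := L) (I := I)).1)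

/-- The trace of the multiplication by `v` on `L[X] / I` is the sum of the values of `v` at the
zeros of `I`, counted with multiplicity. -/
theorem trace_mk_eq_sum [Module.Finite L (MvPolynomial (Fin n) L ⧸ I)]
    (hV : (zeroLocus L I).Finite) (v : MvPolynomial (Fin n) L) :
    Algebra.trace L (MvPolynomial (Fin n) L ⧸ I) (Ideal.Quotient.mk I v) =
      ∑ p ∈ hV.toFinset, (multiplicity I p : L) * eval p v := by
  have : IsArtinianRing (MvPolynomial (Fin n) L ⧸ I) := IsArtinianRing.of_finite L _
  have := Fintype.ofFinite (MaximalSpectrum (MvPolynomial (Fin n) L ⧸ I))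
  have := hV.fintype
  let e := Equiv.ofBijective _ (pointIdeal_bijective (L := L) (I := I))
  have he : ∀ J, pointIdeal (e.symm J) = J := fun J => e.apply_symm_apply J
  rw [trace_eq_sum_maximalSpectrum _ fun J => eval (e.symm J).1 v]
  · rw [← e.sum_comp, Finset.sum_subtype hV.toFinset (p := (· ∈ zeroLocus L I))
      (fun _ => hV.mem_toFinset) (fun p => (multiplicity I p : L) * eval p v)]
    refine Finset.sum_congr rfl fun p _ => ?_
    rw [e.symm_apply_apply, multiplicity_eq]
    rfl
  · intro J
    have h : Ideal.Quotient.mk I (v - C (eval (e.symm J).1 v)) ∈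
        (pointIdeal (e.symm J)).asIdeal := by
      rw [mem_pointIdeal_mk]
      simp
    rw [he] at h
    rwa [map_sub] at h

/-- β - v is a nonunit modulo I iff it lies in a maximal ideal, that is, vanishes at a zero of I. -/
theorem isRoot_charpoly_mk_iff [Module.Finite L (MvPolynomial (Fin n) L ⧸ I)]
    (v : MvPolynomial (Fin n) L) (β : L) :
    (LinearMap.mulLeft L (Ideal.Quotient.mk I v)).charpoly.IsRoot β ↔
      ∃ p ∈ zeroLocus L I, eval p v = β := by
  have h0 : algebraMap L (MvPolynomial (Fin n) L ⧸ I) β - Ideal.Quotient.mk I v =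
      Ideal.Quotient.mk I (C β - v) := by
    rw [map_sub]; rfl
  rw [isRoot_charpoly_mulLeft_iff, h0, ← mem_nonunits_iff]
  constructor
  · intro h
    obtain ⟨J, hJ, hm⟩ := exists_max_ideal_of_mem_nonunits h
    obtain ⟨p, hp⟩ := (pointIdeal_bijective (L := L) (I := I)).2 ⟨J, hJ⟩
    refine ⟨p.1, p.2, ?_⟩
    have : Ideal.Quotient.mk I (C β - v) ∈ (pointIdeal p).asIdeal := by rw [hp]; exact hm
    rw [mem_pointIdeal_mk] at this
    rw [map_sub, eval_C, sub_eq_zero] at this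
    exact this.symm
  · rintro ⟨p, hp, h⟩ hu
    refine (pointIdeal ⟨p, hp⟩).isMaximal.ne_top (Ideal.eq_top_of_isUnit_mem _ ?_ hu)
    rw [mem_pointIdeal_mk]
    simp [h]

end Points

/-! ### Squarefree parts and trace formulas -/

section Squarefree

open Polynomial

variable {L : Type*} [Field L]

/-- Horner's rule: the coefficient of T^r in q / (T - y) is the sum of y^(i-r-1) q_i over i > r. -/
theorem traceFormula_pow (y : L) (q : L[X]) :
    traceFormula (fun a => y ^ a) q = q /ₘ (X - C y) := by
  ext r
  rw [coeff_divByMonic_X_sub_C]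
  simp only [traceFormula, finsetSum_coeff, coeff_monomial]
  have hin : ∀ i ∈ Finset.range q.natDegree,
      (∑ j ∈ Finset.range (q.natDegree - i),
        if q.natDegree - i - j - 1 = r then y ^ i * q.coeff (q.natDegree - j) else 0) =
      if r + 1 + i ≤ q.natDegree then y ^ i * q.coeff (r + 1 + i) else 0 := by
    intro i hi
    rw [Finset.mem_range] at hi
    split_ifs with h
    -- For fixed i, the exponent d - i - j - 1 equals r only when d - j = r + 1 + i.
    · rw [Finset.sum_eq_single (q.natDegree - (r + 1 + i))]
      · rw [if_pos (by omega)]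
        congr 2
        omega
      · intro j hj hne
        rw [Finset.mem_range] at hj
        exact if_neg (by omega)
      · intro hj
        rw [Finset.mem_range] at hj
        omega
    · refine Finset.sum_eq_zero fun j hj => ?_
      rw [Finset.mem_range] at hj
      exact if_neg (by omega)
  rw [Finset.sum_congr rfl hin, ← Finset.sum_filter]
  refine Finset.sum_bij' (fun i _ => r + 1 + i) (fun i _ => i - (r + 1)) ?_ ?_ ?_ ?_ ?_
  · intro i hi
    simp only [Finset.mem_filter, Finset.mem_range, Finset.mem_Icc] at hi ⊢
    omega
  · intro i hi
    simp only [Finset.mem_filter, Finset.mem_range, Finset.mem_Icc] at hi ⊢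
    omega
  · intro i _
    omega
  · intro i hi
    simp only [Finset.mem_Icc] at hi
    omega
  · intro i _
    rw [Nat.add_sub_cancel_left]

theorem traceFormula_sum {ι : Type*} (s : Finset ι) (c : ι → L) (τ : ι → ℕ → L) (q : L[X]) :
    traceFormula (fun a => ∑ i ∈ s, c i * τ i a) q = ∑ i ∈ s, C (c i) * traceFormula (τ i) q := by
  simp only [traceFormula, Finset.mul_sum, C_mul_monomial, Finset.sum_mul, map_sum, mul_assoc]
  rw [Finset.sum_comm]
  refine Finset.sum_congr rfl fun a _ => ?_
  rw [Finset.sum_comm]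

/-- In characteristic 0, differentiation lowers the multiplicity of a root by exactly 1, and the gcd
takes the smaller of the two multiplicities. -/
theorem IsGCD.rootMultiplicity_add_one [CharZero L] {d χ : L[X]} (hχ : χ ≠ 0)
    (h : IsGCD d χ (derivative χ)) {y : L} (hy : χ.IsRoot y) :
    d.rootMultiplicity y + 1 = χ.rootMultiplicity y := by
  have hpos := (rootMultiplicity_pos hχ).2 hy
  have hder := derivative_rootMultiplicity_of_root hy
  have hd0 : d ≠ 0 := fun h0 => hχ (zero_dvd_iff.1 (h0 ▸ h.1))
  have hχ' : derivative χ ≠ 0 := by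
    intro h0
    have := derivative_eq_zero.1 h0
    rw [eq_C_of_natDegree_eq_zero this] at hy hχ
    simp at hy
    simp [hy] at hχ
  have h1 : (X - C y) ^ (χ.rootMultiplicity y - 1) ∣ d := by
    refine h.2.2 _ ?_ ?_
    · exact (pow_dvd_pow _ (Nat.sub_le _ _)).trans (pow_rootMultiplicity_dvd χ y)
    · rw [← hder]
      exact pow_rootMultiplicity_dvd _ y
  have h2 := (le_rootMultiplicity_iff hd0).2 h1
  have h3 := rootMultiplicity_le_rootMultiplicity_of_dvd hχ' h.2.1 y
  omega

open Classical in
-- Multiplicities add in q d = χ, so q has every root of χ exactly once and no others.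
theorem eq_prod_roots_of_mul_isGCD [CharZero L] [IsAlgClosed L] {d χ q : L[X]} (hχ : χ ≠ 0)
    (h : IsGCD d χ (derivative χ)) (hq : q.Monic) (hqd : q * d = χ) :
    q = ∏ y ∈ χ.roots.toFinset, (X - C y) := by
  have hroots : q.roots = χ.roots.toFinset.val := by
    ext y
    rw [count_roots]
    have hmul : q.rootMultiplicity y + d.rootMultiplicity y = χ.rootMultiplicity y := by
      rw [← hqd] at hχ ⊢
      rw [rootMultiplicity_mul hχ]
    rw [Multiset.toFinset_val, Multiset.count_dedup]
    split_ifs with hy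
    · have := h.rootMultiplicity_add_one hχ ((mem_roots hχ).1 hy)
      omega
    · rw [mem_roots hχ] at hy
      have := rootMultiplicity_eq_zero hy
      omega
  have hs := (IsAlgClosed.splits q).eq_prod_roots
  rw [hq.leadingCoeff, C_1, one_mul, hroots] at hs
  exact hs

theorem prod_divByMonic [DecidableEq L] (s : Finset L) {y : L} (hy : y ∈ s) :
    (∏ z ∈ s, (X - C z)) /ₘ (X - C y) = ∏ z ∈ s.erase y, (X - C z) := by
  rw [← Finset.mul_prod_erase s _ hy, mul_divByMonic_cancel_left _ (monic_X_sub_C y)]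

end Squarefree

/-! ### Numerators of the representation and recovery of the zeros -/

section RUR

open MvPolynomial

variable {n : ℕ} {L : Type*} [Field L] {I : Ideal (MvPolynomial (Fin n) L)}

open Classical in
theorem rurNumerator_eq_sum (hV : (zeroLocus L I).Finite) (t v : MvPolynomial (Fin n) L)
    (χ : Polynomial L) :
    rurNumerator I t χ v = ∑ p ∈ hV.toFinset,
      Polynomial.C ((multiplicity I p : L) * eval p v) *
        ∏ y ∈ χ.roots.toFinset.erase (eval p t), (Polynomial.X - Polynomial.C y) :=
  finsum_mem_eq_finite_toFinset_sum _ hV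

variable [IsAlgClosed L] [Module.Finite L (MvPolynomial (Fin n) L ⧸ I)]

/-- The trace formula computes the numerators of the rational univariate representation. -/
theorem traceFormula_eq_rurNumerator [CharZero L] (t v : MvPolynomial (Fin n) L)
    {χ d q : Polynomial L}
    (hχ : χ = (LinearMap.mulLeft L (Ideal.Quotient.mk I t)).charpoly)
    (h : IsGCD d χ (Polynomial.derivative χ)) (hq : q.Monic) (hqd : q * d = χ) :
    traceFormula (fun a => Algebra.trace L (MvPolynomial (Fin n) L ⧸ I)
      (Ideal.Quotient.mk I (v * t ^ a))) q = rurNumerator I t χ v := by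
  classical
  have hχ0 : χ ≠ 0 := hχ ▸ (LinearMap.charpoly_monic _).ne_zero
  have hV := finite_zeroLocus (L := L) (I := I)
  have hτ : (fun a => Algebra.trace L (MvPolynomial (Fin n) L ⧸ I)
      (Ideal.Quotient.mk I (v * t ^ a))) =
      fun a => ∑ p ∈ hV.toFinset, ((multiplicity I p : L) * eval p v) * (eval p t) ^ a := by
    funext a
    rw [trace_mk_eq_sum hV]
    refine Finset.sum_congr rfl fun p _ => ?_
    rw [map_mul, map_pow, mul_assoc]
  rw [hτ, traceFormula_sum hV.toFinset _ (fun p a => (eval p t) ^ a), rurNumerator_eq_sum hV]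
  refine Finset.sum_congr rfl fun p hp => ?_
  rw [traceFormula_pow, eq_prod_roots_of_mul_isGCD hχ0 h hq hqd, prod_divByMonic]
  rw [Multiset.mem_toFinset, Polynomial.mem_roots hχ0, hχ, isRoot_charpoly_mk_iff]
  exact ⟨p, hV.mem_toFinset.1 hp, rfl⟩

open Classical in
-- For a zero p' ≠ p, separation gives t(p') ≠ t(p), so the product belonging to p' keeps the factor
-- T - t(p) and vanishes at t(p).
theorem eval_rurNumerator {t : MvPolynomial (Fin n) L} (ht : IsSeparating t I)
    {χ : Polynomial L} (hχ : χ = (LinearMap.mulLeft L (Ideal.Quotient.mk I t)).charpoly)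
    {p : Fin n → L} (hp : p ∈ zeroLocus L I) (v : MvPolynomial (Fin n) L) :
    (rurNumerator I t χ v).eval (eval p t) = ((multiplicity I p : L) * eval p v) *
      ∏ y ∈ χ.roots.toFinset.erase (eval p t), (eval p t - y) := by
  have hχ0 : χ ≠ 0 := hχ ▸ (LinearMap.charpoly_monic _).ne_zero
  have hV := finite_zeroLocus (L := L) (I := I)
  rw [rurNumerator_eq_sum hV, Polynomial.eval_finsetSum, Finset.sum_eq_single p]
  · simp [Polynomial.eval_prod]
  · intro p' hp' hne
    have hp' := hV.mem_toFinset.1 hp'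
    rw [Polynomial.eval_mul, Polynomial.eval_prod, Finset.prod_eq_zero (i := eval p t), mul_zero]
    · rw [Finset.mem_erase, Multiset.mem_toFinset, Polynomial.mem_roots hχ0, hχ,
        isRoot_charpoly_mk_iff]
      exact ⟨ht p hp p' hp' hne.symm, p, hp, rfl⟩
    · simp
  · intro h
    exact absurd (hV.mem_toFinset.2 hp) h

variable [CharZero L]

theorem eval_rurNumerator_one_ne_zero {t : MvPolynomial (Fin n) L} (ht : IsSeparating t I)
    {χ : Polynomial L} (hχ : χ = (LinearMap.mulLeft L (Ideal.Quotient.mk I t)).charpoly)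
    {p : Fin n → L} (hp : p ∈ zeroLocus L I) :
    (rurNumerator I t χ 1).eval (eval p t) ≠ 0 := by
  classical
  rw [eval_rurNumerator ht hχ hp, map_one, mul_one]
  refine mul_ne_zero (Nat.cast_ne_zero.2 (multiplicity_pos ⟨p, hp⟩).ne') ?_
  refine Finset.prod_ne_zero_iff.2 fun y hy => sub_ne_zero.2 ?_
  exact (Finset.ne_of_mem_erase hy).symm

/-- Both numerators carry the same nonzero factor, μ(p) times the product of differences, which
cancels. -/
theorem eval_rurNumerator_div {t : MvPolynomial (Fin n) L} (ht : IsSeparating t I)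
    {χ : Polynomial L} (hχ : χ = (LinearMap.mulLeft L (Ideal.Quotient.mk I t)).charpoly)
    {p : Fin n → L} (hp : p ∈ zeroLocus L I) (v : MvPolynomial (Fin n) L) :
    (rurNumerator I t χ v).eval (eval p t) / (rurNumerator I t χ 1).eval (eval p t) =
      eval p v := by
  classical
  rw [div_eq_iff (eval_rurNumerator_one_ne_zero ht hχ hp), eval_rurNumerator ht hχ hp,
    eval_rurNumerator ht hχ hp, map_one]
  ring

theorem zeroLocus_eq_of_rur {t : MvPolynomial (Fin n) L} (ht : IsSeparating t I)
    {χ : Polynomial L} (hχ : χ = (LinearMap.mulLeft L (Ideal.Quotient.mk I t)).charpoly) :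
    zeroLocus L I = {x | ∃ β, χ.IsRoot β ∧ ∀ j, x j =
      (rurNumerator I t χ (X j)).eval β / (rurNumerator I t χ 1).eval β} := by
  have hroot : ∀ β, χ.IsRoot β ↔ ∃ p ∈ zeroLocus L I, eval p t = β := fun β => by
    rw [hχ, isRoot_charpoly_mk_iff]
  ext x
  constructor
  · intro hx
    refine ⟨eval x t, (hroot _).2 ⟨x, hx, rfl⟩, fun j => ?_⟩
    rw [eval_rurNumerator_div ht hχ hx, eval_X]
  · rintro ⟨β, hβ, h⟩
    obtain ⟨p, hp, rfl⟩ := (hroot β).1 hβ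
    have : x = p := by
      funext j
      rw [h j, eval_rurNumerator_div ht hχ hp, eval_X]
    exact this ▸ hp

end RUR

/-! ### Specialization of multiplication matrices -/

section MulMatrix

open MvPolynomial

variable {m n : ℕ} {k L : Type*} [Field k] [Field L]
  {ord : MonomialOrder (Fin n)} {G : Finset (MvPolynomial (Fin n) (ParamRing m k))}
  {I : Ideal (MvPolynomial (Fin n) L)}

theorem mk_eq_sum_standardMonomials [Fintype (standardMonomials ord G)]
    {r : MvPolynomial (Fin n) L} (hr : ∀ α ∈ r.support, α ∈ standardMonomials ord G) :
    Ideal.Quotient.mk I r = ∑ α : standardMonomials ord G,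
      coeff α.1 r • Ideal.Quotient.mk I (monomial α.1 1) := by
  have h : r = ∑ α : standardMonomials ord G, coeff α.1 r • monomial α.1 (1 : L) := by
    ext β
    rw [coeff_sum]
    simp only [coeff_smul, coeff_monomial, smul_eq_mul, mul_ite, mul_one, mul_zero]
    by_cases hβ : β ∈ standardMonomials ord G
    · rw [Finset.sum_eq_single ⟨β, hβ⟩]
      · simp
      · intro i _ hi
        exact if_neg fun h => hi (Subtype.ext h)
      · simp
    · rw [Finset.sum_eq_zero]
      · by_contra h
        exact hβ (hr β (mem_support_iff.2 h))
      · intro i _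
        exact if_neg fun h : i.1 = β => hβ (h ▸ i.2)
  conv_lhs => rw [h, map_sum]
  rfl

variable [Algebra k L] {u : Fin m → L}

/-- Specialization can only delete monomials, and the leading one survives. -/
theorem degree_specialize {g : MvPolynomial (Fin n) (ParamRing m k)}
    (hg : aeval u (ord.leadingCoeff g) ≠ 0) : ord.degree (specialize u g) = ord.degree g := by
  apply ord.toSyn.injective
  apply le_antisymm
  · refine ord.degree_le_iff.2 fun α hα => ord.le_degree ?_
    rw [mem_support_iff, specialize, coeff_map] at hα
    rw [mem_support_iff]
    rintro h
    exact hα (by rw [h, map_zero])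
  · refine ord.le_degree ?_
    rw [mem_support_iff, specialize, coeff_map]
    exact hg

theorem leadingCoeff_specialize {g : MvPolynomial (Fin n) (ParamRing m k)}
    (hg : aeval u (ord.leadingCoeff g) ≠ 0) :
    ord.leadingCoeff (specialize u g) = aeval u (ord.leadingCoeff g) := by
  rw [MonomialOrder.leadingCoeff, degree_specialize hg, specialize, coeff_map]
  rfl

/-- A nonzero combination lying in I would have a standard leading monomial, yet the Gröbner
property makes it divisible by a leading monomial of `G`. -/
theorem linearIndependent_standardMonomials
    (hlc : ∀ g ∈ G, aeval u (ord.leadingCoeff g) ≠ 0)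
    (hG : IsGroebnerBasis ord
      (specialize u '' (G : Set (MvPolynomial (Fin n) (ParamRing m k)))) I) :
    LinearIndependent L (fun β : standardMonomials ord G =>
      Ideal.Quotient.mk I (monomial β.1 1)) := by
  rw [linearIndependent_iff']
  intro s c hc β hβ
  set p : MvPolynomial (Fin n) L := ∑ i ∈ s, monomial i.1 (c i) with hp
  have hpI : p ∈ I := by
    rw [← Ideal.Quotient.eq_zero_iff_mem, hp, map_sum, ← hc]
    refine Finset.sum_congr rfl fun i _ => ?_
    rw [← mul_one (c i), ← smul_eq_mul, ← smul_monomial]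
    simp
    rfl
  have hcoeff : ∀ α, coeff α p = ∑ i ∈ s, if i.1 = α then c i else 0 := fun α => by
    rw [hp, coeff_sum]
    exact Finset.sum_congr rfl fun i _ => coeff_monomial _ _ _
  have hp0 : p = 0 := by
    by_contra h0
    obtain ⟨_, ⟨g, hg, rfl⟩, -, hle⟩ := hG.2 p hpI h0
    rw [degree_specialize (hlc g hg)] at hle
    have hmem : coeff (ord.degree p) p ≠ 0 := ord.leadingCoeff_ne_zero_iff.2 h0
    rw [hcoeff] at hmem
    obtain ⟨i, -, hi⟩ := Finset.exists_ne_zero_of_sum_ne_zero hmem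
    have hi' : i.1 = ord.degree p := by
      by_contra h
      exact hi (if_neg h)
    exact i.2 g hg (hi' ▸ hle)
  have := hcoeff β.1
  rw [hp0, coeff_zero, Finset.sum_eq_single β] at this
  · simpa using this.symm
  · intro i _ hi
    exact if_neg fun h => hi (Subtype.ext h)
  · exact fun h => absurd hβ h

theorem finite_standardMonomials [Module.Finite L (MvPolynomial (Fin n) L ⧸ I)]
    (hlc : ∀ g ∈ G, aeval u (ord.leadingCoeff g) ≠ 0)
    (hG : IsGroebnerBasis ord
      (specialize u '' (G : Set (MvPolynomial (Fin n) (ParamRing m k)))) I) :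
    Finite (standardMonomials ord G) :=
  (linearIndependent_standardMonomials hlc hG).finite

theorem span_standardMonomials [Fintype (standardMonomials ord G)]
    (hlc : ∀ g ∈ G, aeval u (ord.leadingCoeff g) ≠ 0)
    (hG : IsGroebnerBasis ord
      (specialize u '' (G : Set (MvPolynomial (Fin n) (ParamRing m k)))) I) :
    ⊤ ≤ Submodule.span L (Set.range fun β : standardMonomials ord G =>
      Ideal.Quotient.mk I (monomial β.1 1)) := by
  rintro w -
  obtain ⟨v, rfl⟩ := Ideal.Quotient.mk_surjective w
  obtain ⟨q, r, h1, -, h3⟩ := ord.div (b := fun g : G => specialize u g.1)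
    (fun g => by
      rw [leadingCoeff_specialize (hlc g.1 g.2)]
      exact isUnit_iff_ne_zero.2 (hlc g.1 g.2)) v
  have hv : Ideal.Quotient.mk I v = Ideal.Quotient.mk I r := by
    rw [Ideal.Quotient.eq, h1, add_sub_cancel_right, Finsupp.linearCombination_apply]
    exact Submodule.sum_mem _ fun g _ => I.mul_mem_left _ (hG.1 _ ⟨g.1, g.2, rfl⟩)
  rw [hv, mk_eq_sum_standardMonomials (ord := ord) (G := G)]
  · exact Submodule.sum_mem _ fun α _ =>
      Submodule.smul_mem _ _ (Submodule.subset_span ⟨α, rfl⟩)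
  · intro α hα g hg hle
    refine h3 α hα ⟨g, hg⟩ ?_
    dsimp only
    rwa [degree_specialize (hlc g hg)]

/-- The standard monomials form a basis of the quotient at every good parameter value. -/
def standardBasis [Fintype (standardMonomials ord G)]
    (hlc : ∀ g ∈ G, aeval u (ord.leadingCoeff g) ≠ 0)
    (hG : IsGroebnerBasis ord
      (specialize u '' (G : Set (MvPolynomial (Fin n) (ParamRing m k)))) I) :
    Module.Basis (standardMonomials ord G) L (MvPolynomial (Fin n) L ⧸ I) :=
  Module.Basis.mk (linearIndependent_standardMonomials hlc hG) (span_standardMonomials hlc hG)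

theorem standardBasis_repr_mk [Fintype (standardMonomials ord G)]
    (hlc : ∀ g ∈ G, aeval u (ord.leadingCoeff g) ≠ 0)
    (hG : IsGroebnerBasis ord
      (specialize u '' (G : Set (MvPolynomial (Fin n) (ParamRing m k)))) I)
    {r : MvPolynomial (Fin n) L} (hr : ∀ α ∈ r.support, α ∈ standardMonomials ord G)
    (α : standardMonomials ord G) :
    (standardBasis hlc hG).repr (Ideal.Quotient.mk I r) α = coeff α.1 r := by
  rw [mk_eq_sum_standardMonomials hr]
  have : ∀ β : standardMonomials ord G,
      Ideal.Quotient.mk I (monomial β.1 1) = standardBasis hlc hG β := fun β => by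
    rw [standardBasis, Module.Basis.mk_apply]
  simp only [this]
  rw [Module.Basis.repr_sum_self]

/-- All coefficients of the division identity are defined at `u`, so it lifts to `definedSubring`
and can be evaluated; the terms with G(u) then fall into I. -/
theorem IsRemainder.exists_specialization
    (hlc : ∀ g ∈ G, aeval u (ord.leadingCoeff g) ≠ 0)
    (hGI : ∀ g ∈ G, specialize u g ∈ I)
    {p : MvPolynomial (Fin n) (definedSubring k u)} {r : MvPolynomial (Fin n) (ParamField m k)}
    (h : IsRemainder ord G (map (definedSubring k u).subtype p) r) :
    (∀ α, IsDefinedAt u (coeff α r)) ∧ ∃ r' : MvPolynomial (Fin n) L,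
      (∀ α, coeff α r' = evalFrac u (coeff α r)) ∧
      (∀ α ∈ r'.support, α ∈ standardMonomials ord G) ∧
      map (evalDefined k u) p - r' ∈ I := by
  obtain ⟨q, h1, -, h3, h4, h5⟩ := h
  have hr := fun α => (h5 α).isDefinedAt hlc
  refine ⟨hr, ?_⟩
  obtain ⟨r₀, rfl⟩ := exists_mvPolynomial_lift hr
  have hq : ∀ g : MvPolynomial (Fin n) (ParamRing m k), ∃ q' : MvPolynomial (Fin n)
      (definedSubring k u), g ∈ G → map (definedSubring k u).subtype q' = q g := fun g => by
    by_cases hg : g ∈ G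
    · obtain ⟨q', hq'⟩ := exists_mvPolynomial_lift fun α => (h4 g hg α).isDefinedAt hlc
      exact ⟨q', fun _ => hq'⟩
    · exact ⟨0, fun h => absurd h hg⟩
  choose q' hq' using hq
  have heq : p = (∑ g ∈ G, q' g * map (toDefined k u) g) + r₀ := by
    apply map_injective (definedSubring k u).subtype Subtype.val_injective
    rw [h1, map_add, map_sum]
    congr 1
    refine Finset.sum_congr rfl fun g hg => ?_
    rw [map_mul, hq' g hg, map_map, subtype_comp_toDefined]
  refine ⟨map (evalDefined k u) r₀, fun α => ?_, fun α hα => h3 α ?_, ?_⟩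
  · rw [coeff_map, coeff_map]; rfl
  · rw [support_map_of_injective _ Subtype.val_injective]
    exact support_map_subset _ _ hα
  · rw [heq, map_add, add_sub_cancel_right, map_sum]
    refine Submodule.sum_mem _ fun g hg => ?_
    rw [map_mul, map_map, evalDefined_comp_toDefined]
    exact I.mul_mem_left _ (hGI g hg)

/-- The evaluated remainder represents v X^β modulo I and is supported on standard monomials, so its
coefficients are the coordinates of v X^β. -/
theorem IsMulMatrix.specialization [Fintype (standardMonomials ord G)]
    [DecidableEq (standardMonomials ord G)]
    (hlc : ∀ g ∈ G, aeval u (ord.leadingCoeff g) ≠ 0)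
    (hG : IsGroebnerBasis ord
      (specialize u '' (G : Set (MvPolynomial (Fin n) (ParamRing m k)))) I)
    {v : MvPolynomial (Fin n) k}
    {M : Matrix (standardMonomials ord G) (standardMonomials ord G) (ParamField m k)}
    (hM : IsMulMatrix ord G v M) :
    (∀ α β, IsDefinedAt u (M α β)) ∧
      LinearMap.toMatrix (standardBasis hlc hG) (standardBasis hlc hG)
        (LinearMap.mulLeft L (Ideal.Quotient.mk I (map (algebraMap k L) v))) =
      M.map (evalFrac u) := by
  have key : ∀ β : standardMonomials ord G, ∃ r : MvPolynomial (Fin n) (ParamField m k),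
      (∀ α : standardMonomials ord G, M α β = r.coeff α.1) ∧
      (∀ α, IsDefinedAt u (coeff α r)) ∧ ∃ r' : MvPolynomial (Fin n) L,
      (∀ α, coeff α r' = evalFrac u (coeff α r)) ∧
      (∀ α ∈ r'.support, α ∈ standardMonomials ord G) ∧
      map (algebraMap k L) v * monomial β.1 1 - r' ∈ I := by
    intro β
    obtain ⟨r, hr, hMr⟩ := hM β
    let φ : k →+* definedSubring k u := (toDefined k u).comp (algebraMap k (ParamRing m k))
    have hφ : (definedSubring k u).subtype.comp φ = algebraMap k (ParamField m k) := by
      rw [← RingHom.comp_assoc, subtype_comp_toDefined, ← IsScalarTower.algebraMap_eq]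
    have hφ' : (evalDefined k u).comp φ = algebraMap k L := by
      rw [← RingHom.comp_assoc, evalDefined_comp_toDefined]
      exact RingHom.ext fun c => (aeval u : ParamRing m k →ₐ[k] L).commutes c
    have h1 : map (definedSubring k u).subtype (map φ v * monomial β.1 1) =
        map (algebraMap k (ParamField m k)) v * monomial β.1 1 := by
      rw [map_mul, map_map, hφ, map_monomial, map_one]
    have h2 : map (evalDefined k u) (map φ v * monomial β.1 1) =
        map (algebraMap k L) v * monomial β.1 1 := by
      rw [map_mul, map_map, hφ', map_monomial, map_one]
    rw [← h1] at hr
    have := hr.exists_specialization hlc (fun g hg => hG.1 _ ⟨g, hg, rfl⟩)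
    rw [h2] at this
    exact ⟨r, hMr, this⟩
  constructor
  · intro α β
    obtain ⟨r, hMr, hd, -⟩ := key β
    rw [hMr]
    exact hd _
  · ext α β
    obtain ⟨r, hMr, -, r', hr', hsupp, hmem⟩ := key β
    rw [LinearMap.toMatrix_apply, Matrix.map_apply, hMr, ← hr',
      ← standardBasis_repr_mk hlc hG hsupp α, ← Ideal.Quotient.eq.2 hmem, map_mul,
      LinearMap.mulLeft_apply]
    congr 3
    rw [standardBasis, Module.Basis.mk_apply]

theorem IsMulMatrix.exists_charPoly_lift [Module.Finite L (MvPolynomial (Fin n) L ⧸ I)]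
    (hlc : ∀ g ∈ G, aeval u (ord.leadingCoeff g) ≠ 0)
    (hG : IsGroebnerBasis ord
      (specialize u '' (G : Set (MvPolynomial (Fin n) (ParamRing m k)))) I)
    {v : MvPolynomial (Fin n) k}
    {M : Matrix (standardMonomials ord G) (standardMonomials ord G) (ParamField m k)}
    (hM : IsMulMatrix ord G v M) :
    ∃ χ : Polynomial (definedSubring k u), χ.Monic ∧
      χ.map (definedSubring k u).subtype = charPoly M ∧
      χ.map (evalDefined k u) =
        (LinearMap.mulLeft L (Ideal.Quotient.mk I (map (algebraMap k L) v))).charpoly := by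
  classical
  have hfin := finite_standardMonomials hlc hG
  let := Fintype.ofFinite (standardMonomials ord G)
  obtain ⟨hd, hmat⟩ := hM.specialization hlc hG
  let M' : Matrix (standardMonomials ord G) (standardMonomials ord G) (definedSubring k u) :=
    fun α β => ⟨M α β, hd α β⟩
  refine ⟨M'.charpoly, M'.charpoly_monic, ?_, ?_⟩
  · rw [← Matrix.charpoly_map, charPoly, dif_pos hfin]
    congr 1
  · rw [← Matrix.charpoly_map, ← LinearMap.charpoly_toMatrix _ (standardBasis hlc hG), hmat]
    rfl

theorem IsMulMatrix.exists_trace_lift [Module.Finite L (MvPolynomial (Fin n) L ⧸ I)]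
    (hlc : ∀ g ∈ G, aeval u (ord.leadingCoeff g) ≠ 0)
    (hG : IsGroebnerBasis ord
      (specialize u '' (G : Set (MvPolynomial (Fin n) (ParamRing m k)))) I)
    {v : MvPolynomial (Fin n) k}
    {M : Matrix (standardMonomials ord G) (standardMonomials ord G) (ParamField m k)}
    (hM : IsMulMatrix ord G v M) :
    ∃ τ : definedSubring k u, (τ : ParamField m k) = trace M ∧
      evalDefined k u τ = Algebra.trace L (MvPolynomial (Fin n) L ⧸ I)
        (Ideal.Quotient.mk I (map (algebraMap k L) v)) := by
  classical
  have hfin := finite_standardMonomials hlc hG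
  let := Fintype.ofFinite (standardMonomials ord G)
  obtain ⟨hd, hmat⟩ := hM.specialization hlc hG
  refine ⟨∑ α, ⟨M α α, hd α α⟩, ?_, ?_⟩
  · rw [trace, finsum_eq_sum_of_fintype]
    exact map_sum (definedSubring k u).subtype _ _
  · rw [map_sum, Algebra.trace_apply, LinearMap.trace_eq_matrix_trace L (standardBasis hlc hG)]
    have : Algebra.lmul L (MvPolynomial (Fin n) L ⧸ I)
        (Ideal.Quotient.mk I (map (algebraMap k L) v)) =
        LinearMap.mulLeft L (Ideal.Quotient.mk I (map (algebraMap k L) v)) := rfl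
    rw [this, hmat]
    rfl

end MulMatrix

/-! ### Specialization of the trace formula -/

section TraceFormula

open Polynomial

/-- The expression defining `traceFormula`, over an arbitrary commutative ring. -/
def traceSum {R : Type*} [CommRing R] (τ : ℕ → R) (q : R[X]) : R[X] :=
  ∑ i ∈ Finset.range q.natDegree, ∑ j ∈ Finset.range (q.natDegree - i),
    monomial (q.natDegree - i - j - 1) (τ i * q.coeff (q.natDegree - j))

/-- The formula is indexed by the degree of `q`; monicity keeps that degree unchanged under the map.
-/
theorem map_traceSum {R K : Type*} [CommRing R] [Field K] (φ : R →+* K) (τ : ℕ → R) {q : R[X]}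
    (hq : q.Monic) : (traceSum τ q).map φ = traceFormula (fun a => φ (τ a)) (q.map φ) := by
  rw [traceFormula, hq.natDegree_map]
  simp [traceSum, Polynomial.map_sum]

end TraceFormula

/-! ### Clearing denominators and specializing the squarefree quotient -/

section Lifts

open Polynomial

variable {m : ℕ} {k L : Type*} [Field k] [Field L] [Algebra k L]

/-- Denominators can be cleared uniformly on a set of points where all coefficients are defined. -/
theorem exists_clear_denominators (S : Set (Fin m → L)) (p : (ParamField m k)[X])
    (hp : ∀ u ∈ S, PolyDefinedAt u p) :
    ∃ (c : ParamRing m k) (a : (ParamRing m k)[X]), (∀ u ∈ S, MvPolynomial.aeval u c ≠ 0) ∧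
      a.map (algebraMap (ParamRing m k) (ParamField m k)) =
        C (algebraMap (ParamRing m k) (ParamField m k) c) * p := by
  let den : ℕ → ParamRing m k := fun i => IsFractionRing.den (ParamRing m k) (p.coeff i)
  let c := ∏ i ∈ Finset.range (p.natDegree + 1), den i
  have hlift : C (algebraMap (ParamRing m k) (ParamField m k) c) * p ∈
      Polynomial.lifts (algebraMap (ParamRing m k) (ParamField m k)) := by
    rw [Polynomial.lifts_iff_coeff_lifts]
    intro i
    rw [coeff_C_mul]
    by_cases hi : i ∈ Finset.range (p.natDegree + 1)
    · obtain ⟨e, he⟩ := Finset.dvd_prod_of_mem den hi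
      refine ⟨IsFractionRing.num (ParamRing m k) (p.coeff i) * e, ?_⟩
      change _ = algebraMap _ _ (∏ i ∈ Finset.range (p.natDegree + 1), den i) * _
      have h : p.coeff i * algebraMap (ParamRing m k) (ParamField m k) (den i) =
          algebraMap _ _ (IsFractionRing.num (ParamRing m k) (p.coeff i)) :=
        IsFractionRing.num_mul_den_eq_num_iff_eq.2 rfl
      rw [he, map_mul, map_mul, ← h]
      ring
    · refine ⟨0, ?_⟩
      rw [Finset.mem_range] at hi
      rw [coeff_eq_zero_of_natDegree_lt (by omega), mul_zero, map_zero]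
  obtain ⟨a, ha⟩ := (Polynomial.mem_lifts _).1 hlift
  refine ⟨c, a, fun u hu => ?_, ha⟩
  rw [map_prod]
  exact Finset.prod_ne_zero_iff.2 fun i _ => hp u hu i

/-- Links the Euclidean algorithm, which needs coefficients in k[U], to χ: at `u` the two
polynomials differ only by the constant c(u). -/
theorem map_evalParam_eq {u : Fin m → L} {c : ParamRing m k} {a : (ParamRing m k)[X]}
    {χ : (definedSubring k u)[X]}
    (h : a.map (algebraMap (ParamRing m k) (ParamField m k)) =
      C (algebraMap (ParamRing m k) (ParamField m k) c) * χ.map (definedSubring k u).subtype) :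
    a.map (evalParam u) = C (MvPolynomial.aeval u c) * χ.map (evalDefined k u) := by
  have h1 : a.map (toDefined k u) = C (toDefined k u c) * χ := by
    apply map_injective (definedSubring k u).subtype Subtype.val_injective
    rw [Polynomial.map_mul, Polynomial.map_map, map_C, subtype_comp_toDefined, h]
    rfl
  have h2 := congrArg (Polynomial.map (evalDefined k u)) h1
  rw [Polynomial.map_map, evalDefined_comp_toDefined, Polynomial.map_mul, map_C] at h2
  rw [h2]
  congr 2
  exact evalFrac_algebraMap u c

/-- The monic multiple of `d` specializes wherever the leading coefficient of `d` does not
vanish. -/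
theorem exists_monicMultiple_lift {u : Fin m → L} {d : (ParamRing m k)[X]}
    (hd : MvPolynomial.aeval u d.leadingCoeff ≠ 0) :
    ∃ e : (definedSubring k u)[X], e.Monic ∧
      e.map (definedSubring k u).subtype = monicMultiple d ∧
      e.map (evalDefined k u) =
        C (MvPolynomial.aeval u d.leadingCoeff)⁻¹ * d.map (evalParam u) := by
  have hd0 : algebraMap (ParamRing m k) (ParamField m k) d.leadingCoeff ≠ 0 := fun h => by
    rw [(IsFractionRing.injective (ParamRing m k) (ParamField m k)) (h.trans (map_zero _).symm)]
      at hd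
    exact hd (map_zero _)
  have hinv : (algebraMap (ParamRing m k) (ParamField m k) d.leadingCoeff)⁻¹ *
      algebraMap (ParamRing m k) (ParamField m k) d.leadingCoeff =
        algebraMap (ParamRing m k) (ParamField m k) 1 := by
    rw [inv_mul_cancel₀ hd0, map_one]
  have hdef := isDefinedAt_and_evalFrac_mul hd hinv
  -- The inverse leading coefficient is the fraction 1 / lc(d), defined at `u` because lc(d) does
  -- not vanish there.
  let c : definedSubring k u := ⟨_, hdef.1⟩
  have hlc : (d.map (toDefined k u)).leadingCoeff = toDefined k u d.leadingCoeff :=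
    leadingCoeff_map_of_injective
      (fun x y hxy => IsFractionRing.injective (ParamRing m k) (ParamField m k)
        (congrArg Subtype.val hxy)) _
  refine ⟨C c * d.map (toDefined k u), ?_, ?_, ?_⟩
  · refine monic_C_mul_of_mul_leadingCoeff_eq_one ?_
    rw [hlc]
    exact Subtype.ext (hinv.trans (map_one _))
  · rw [Polynomial.map_mul, map_C, Polynomial.map_map, subtype_comp_toDefined]
    rfl
  · rw [Polynomial.map_mul, map_C, Polynomial.map_map, evalDefined_comp_toDefined]
    congr 2
    refine eq_inv_of_mul_eq_one_left ?_
    rw [evalDefined_apply, hdef.2, map_one]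

theorem IsGCD.unit_mul_left {A : Type*} [CommRing A] {d a b c : A} (hc : IsUnit c)
    (h : IsGCD d a b) : IsGCD (c * d) a b :=
  ⟨(hc.mul_left_dvd).2 h.1, (hc.mul_left_dvd).2 h.2.1,
    fun e ha hb => (h.2.2 e ha hb).mul_left c⟩

/-- The quotient of `χ` by the monic multiple of `d` specializes to the squarefree part of the
specialization of `χ`. -/
theorem exists_quotient_lift {u : Fin m → L} {d : (ParamRing m k)[X]}
    (hd : MvPolynomial.aeval u d.leadingCoeff ≠ 0) {χ : (definedSubring k u)[X]} (hχ : χ.Monic)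
    (hgcd : IsGCD (d.map (evalParam u)) (χ.map (evalDefined k u))
      (derivative (χ.map (evalDefined k u)))) :
    ∃ (q : (definedSubring k u)[X]) (e : L[X]), q.Monic ∧
      q.map (definedSubring k u).subtype =
        χ.map (definedSubring k u).subtype /ₘ monicMultiple d ∧
      IsGCD e (χ.map (evalDefined k u)) (derivative (χ.map (evalDefined k u))) ∧
      q.map (evalDefined k u) * e = χ.map (evalDefined k u) := by
  obtain ⟨e, he, he1, he2⟩ := exists_monicMultiple_lift hd
  have hg : IsGCD (e.map (evalDefined k u)) (χ.map (evalDefined k u))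
      (derivative (χ.map (evalDefined k u))) := by
    rw [he2]
    exact hgcd.unit_mul_left (isUnit_C.2 (isUnit_iff_ne_zero.2 (inv_ne_zero hd)))
  -- Divisibility is known only after specialization; both polynomials are monic, so the degree
  -- comparison carries back.
  have hdeg : e.degree ≤ χ.degree := by
    have := degree_le_of_dvd hg.1 (hχ.map _).ne_zero
    rwa [he.degree_map, hχ.degree_map] at this
  refine ⟨χ /ₘ e, e.map (evalDefined k u), ?_, ?_, hg, ?_⟩
  · rw [Monic, leadingCoeff_divByMonic_of_monic he hdeg]
    exact hχ
  · rw [map_divByMonic _ he, he1]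
  -- The division need not be exact over k(U). Monic division commutes with evaluation, and at `u`
  -- the remainder is 0.
  · rw [map_divByMonic _ he, mul_comm]
    have h1 := modByMonic_add_div (χ.map (evalDefined k u)) (e.map (evalDefined k u))
    rwa [(modByMonic_eq_zero_iff_dvd (he.map _)).2 hg.1, zero_add] at h1

end Lifts

end ParametricRUR

end

/-! ### Assembly of the pieces -/

theorem theorem18 {k L : Type*} [Field k] [CharZero k] [Field L] [Algebra k L]
    [IsAlgClosure k L] {m n l : ℕ} (ord : MonomialOrder (Fin n))
    (f : Fin l → MvPolynomial (Fin n) (ParamRing m k))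
    (E N : Set (ParamRing m k))
    (G : Finset (MvPolynomial (Fin n) (ParamRing m k)))
    (t : MvPolynomial (Fin n) k)
    (hzero : ∀ u ∈ locallyClosed L E N, ZeroDimensional (specializedIdeal f u))
    (hG : ∀ u ∈ locallyClosed L E N,
      IsGroebnerBasis ord (specialize u '' (G : Set (MvPolynomial (Fin n) (ParamRing m k)))) (specializedIdeal f u))
    (hlc : ∀ u ∈ locallyClosed L E N, ∀ g ∈ G,
      MvPolynomial.aeval u (ord.leadingCoeff g) ≠ 0)
    (ht : ∀ u ∈ locallyClosed L E N,
      IsSeparating (MvPolynomial.map (algebraMap k L) t) (specializedIdeal f u))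
    (M : MvPolynomial (Fin n) k →
      Matrix (standardMonomials ord G) (standardMonomials ord G) (ParamField m k))
    (hM : ∀ v, IsMulMatrix ord G v (M v)) :
    (∀ u ∈ locallyClosed L E N, PolyDefinedAt u (charPoly (M t))) ∧
    ∃ (s : ℕ) (E' N' : Fin s → Finset (ParamRing m k))
      (d : Fin s → Polynomial (ParamRing m k))
      (g : Fin s → Polynomial (ParamField m k))
      (h : Fin s → Fin n → Polynomial (ParamField m k)),
      locallyClosed L E N =
        ⋃ i, locallyClosed L (E' i : Set (ParamRing m k)) (N' i : Set (ParamRing m k)) ∧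
      ∀ i,
        g i = traceFormula (fun a => trace (M (t ^ a)))
          (charPoly (M t) /ₘ monicMultiple (d i)) ∧
        (∀ j, h i j = traceFormula (fun a => trace (M (MvPolynomial.X j * t ^ a)))
          (charPoly (M t) /ₘ monicMultiple (d i))) ∧
        ∀ u ∈ locallyClosed L (E' i : Set (ParamRing m k)) (N' i : Set (ParamRing m k)),
          MvPolynomial.aeval u (d i).leadingCoeff ≠ 0 ∧
          IsGCD ((d i).map (MvPolynomial.aeval u : ParamRing m k →ₐ[k] L).toRingHom)
            (specializePoly u (charPoly (M t)))
            (Polynomial.derivative (specializePoly u (charPoly (M t)))) ∧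
          PolyDefinedAt u (g i) ∧ (∀ j, PolyDefinedAt u (h i j)) ∧
          IsRUR (specializedIdeal f u) (MvPolynomial.map (algebraMap k L) t)
            (specializePoly u (charPoly (M t))) (specializePoly u (g i))
            (fun j => specializePoly u (h i j)) ∧
          (∀ β, (specializePoly u (charPoly (M t))).IsRoot β →
            (specializePoly u (g i)).eval β ≠ 0) ∧
          MvPolynomial.zeroLocus L (specializedIdeal f u) =
            {x | ∃ β, (specializePoly u (charPoly (M t))).IsRoot β ∧
              ∀ j, x j = (specializePoly u (h i j)).eval β / (specializePoly u (g i)).eval β} := by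
  classical
  have : IsAlgClosed L := IsAlgClosure.isAlgClosed k
  have : CharZero L := charZero_of_injective_algebraMap (algebraMap k L).injective
  have hbasis : ∀ u ∈ locallyClosed L E N, ∃ χ : Polynomial (definedSubring k u), χ.Monic ∧
      χ.map (definedSubring k u).subtype = charPoly (M t) ∧
      ∃ _ : Module.Finite L (MvPolynomial (Fin n) L ⧸ specializedIdeal f u),
        χ.map (evalDefined k u) = (LinearMap.mulLeft L (Ideal.Quotient.mk (specializedIdeal f u)
          (MvPolynomial.map (algebraMap k L) t))).charpoly := by
    intro u hu
    have hfin : Module.Finite L (MvPolynomial (Fin n) L ⧸ specializedIdeal f u) := hzero u hu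
    obtain ⟨χ, h1, h2, h3⟩ := (hM t).exists_charPoly_lift (hlc u hu) (hG u hu)
    exact ⟨χ, h1, h2, hfin, h3⟩
  have hdef : ∀ u ∈ locallyClosed L E N, PolyDefinedAt u (charPoly (M t)) := by
    intro u hu
    obtain ⟨χ, -, h, -⟩ := hbasis u hu
    rw [← h]
    exact polyDefinedAt_map χ
  refine ⟨hdef, ?_⟩
  -- One pair (c, a) serves all good `u`, so the algorithm runs once on a and its derivative.
  obtain ⟨c, a, hc, ha⟩ := exists_clear_denominators (locallyClosed L E N) (charPoly (M t)) hdef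
  have hspec : ∀ u ∈ locallyClosed L E N, a.map (evalParam u) =
      Polynomial.C (MvPolynomial.aeval u c) * specializePoly u (charPoly (M t)) := by
    intro u hu
    obtain ⟨χ, -, h, -⟩ := hbasis u hu
    rw [← h] at ha ⊢
    rw [specializePoly_map]
    exact map_evalParam_eq ha
  obtain ⟨E₀, N₀, hS⟩ := exists_finset_locallyClosed_eq L E N
  obtain ⟨F, hF, hF'⟩ : HasGCDCover L (locallyClosed L E N) a (Polynomial.derivative a) := by
    rw [hS]
    refine hasGCDCover _ _ _ _ fun u hu => Or.inl ?_
    rw [← hS] at hu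
    obtain ⟨χ, hχ, h, -⟩ := hbasis u hu
    rw [hspec u hu, ← h, specializePoly_map]
    exact mul_ne_zero (Polynomial.C_ne_zero.2 (hc u hu)) (hχ.map _).ne_zero
  refine ⟨F.length, fun i => (F.get i).1, fun i => (F.get i).2.1, fun i => (F.get i).2.2,
    fun i => traceFormula (fun a => trace (M (t ^ a)))
      (charPoly (M t) /ₘ monicMultiple (F.get i).2.2),
    fun i j => traceFormula (fun a => trace (M (MvPolynomial.X j * t ^ a)))
      (charPoly (M t) /ₘ monicMultiple (F.get i).2.2), ?_, ?_⟩
  · ext u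
    rw [hF, Set.mem_iUnion]
    constructor
    · rintro ⟨x, hx, hu⟩
      obtain ⟨i, rfl⟩ := List.mem_iff_get.1 hx
      exact ⟨i, hu⟩
    · rintro ⟨i, hu⟩
      exact ⟨_, List.get_mem F i, hu⟩
  intro i
  refine ⟨rfl, fun _ => rfl, fun u hui => ?_⟩
  have hu : u ∈ locallyClosed L E N := (hF u).2 ⟨_, List.get_mem F i, hui⟩
  obtain ⟨hd, hgcd⟩ := hF' _ (List.get_mem F i) u hui
  obtain ⟨χ, hχ, hχ1, hfin, hχ2⟩ := hbasis u hu
  have hcu : IsUnit (Polynomial.C (MvPolynomial.aeval u c)) :=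
    Polynomial.isUnit_C.2 (isUnit_iff_ne_zero.2 (hc u hu))
  -- As c(u) is constant in T, it scales the polynomial and its derivative alike and cancels from
  -- the gcd.
  rw [← Polynomial.derivative_map, hspec u hu, Polynomial.derivative_C_mul] at hgcd
  replace hgcd := hgcd.of_unit_mul hcu
  rw [← hχ1, specializePoly_map] at hgcd ⊢
  obtain ⟨q, e, hq, hq1, he, hqe⟩ := exists_quotient_lift hd hχ hgcd
  beta_reduce
  rw [← hq1]
  have hlift : ∀ v : MvPolynomial (Fin n) k, ∃ g : Polynomial (definedSubring k u),
      g.map (definedSubring k u).subtype = traceFormula (fun a => trace (M (v * t ^ a)))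
        (q.map (definedSubring k u).subtype) ∧
      g.map (evalDefined k u) = rurNumerator (specializedIdeal f u)
        (MvPolynomial.map (algebraMap k L) t) (χ.map (evalDefined k u))
        (MvPolynomial.map (algebraMap k L) v) := by
    -- Needed for v = 1, giving the denominator, and v = X_j, giving the coordinate numerators.
    intro v
    choose τ hτ1 hτ2 using fun a => (hM (v * t ^ a)).exists_trace_lift (hlc u hu) (hG u hu)
    refine ⟨traceSum τ q, ?_, ?_⟩
    · rw [map_traceSum _ _ hq]
      simp only [Subring.subtype_apply, hτ1]
    · rw [map_traceSum _ _ hq, ← traceFormula_eq_rurNumerator _ _ hχ2 he (hq.map _) hqe]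
      simp only [hτ2, map_mul, map_pow]
  obtain ⟨g, hg1, hg2⟩ := hlift 1
  choose h hh1 hh2 using fun j => hlift (MvPolynomial.X j)
  simp only [one_mul, map_one, MvPolynomial.map_X] at hg1 hg2 hh2
  simp only [← hg1, ← hh1, specializePoly_map, hg2, hh2]
  refine ⟨hd, hgcd, polyDefinedAt_map g, fun j => polyDefinedAt_map (h j),
    ⟨hfin, ht u hu, hχ2, rfl, fun _ => rfl⟩, fun β hβ => ?_, zeroLocus_eq_of_rur (ht u hu) hχ2⟩
  rw [hχ2, isRoot_charpoly_mk_iff] at hβ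
  obtain ⟨p, hp, rfl⟩ := hβ
  exact eval_rurNumerator_one_ne_zero (ht u hu) hχ2 hp
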